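/- **Conventions.** A cpo is a poset with suprema of increasing $\omega$-chains; $\mathbf{CPO}$-categories (homsets are cpo's, composition is Scott continuous) and $\mathbf{CPO}$-functors (Scott continuous on homsets) are defined accordingly. An embedding $e:X\to Y$ in a $\mathbf{CPO}$-category is a morphism with a (unique) projection $e^\bullet:Y\to X$ such that $e^\bullet\circ e=\mathrm{id}$ and $e\circ e^\bullet\le \mathrm{id}$. An $\omega$-category is a category with an initial object and all $\omega$-colimits (colimits of diagrams of shape $0\to1\to2\to\cdots$); an $\omega$-functor preserves $\omega$-colimits, and it is strict if it also preserves initial objects. **Model.** Fix a $\mathbf{CPO}$-LNL model: a $\mathbf{CPO}$-symmetric monoidal closed category $(\mathbf L,\otimes,\multimap,I)$ with finite $\mathbf{CPO}$-coproducts $(+,0)$; a $\mathbf{CPO}$-cartesian monoidal category $(\mathbf C,\times,1)$ with finite $\mathbf{CPO}$-coproducts $(\amalg,\varnothing)$; and a $\mathbf{CPO}$-enriched symmetric monoidal adjunction $F\dashv G$ with $F:\mathbf C\to\mathbf L$; such that every morphism of $\mathbf L$ with source $0$ is an embedding, $\mathbf L$ has all $\omega$-colimits over embeddings, $\mathbf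 C$ has all $\omega$-colimits over pre-embeddings (morphisms $f$ such that $Ff$ is an embedding), and the functor $\times:\mathbf C\times\mathbf C\to\mathbf C$ preserves them. Write $!=F\circ G$. Let $\mathbf L_e$ be the wide subcategory of embeddings of $\mathbf L$ and $\mathbf C_{pe}$ the wide subcategory of pre-embeddings of $\mathbf C$; both are $\omega$-categories. Let $F_{pe}:\mathbf C_{pe}\to\mathbf L_e$ (a strict $\omega$-functor), $G_{pe}:\mathbf L_e\to\mathbf C_{pe}$, $!_e,\ \otimes_e,\ +_e$ on $\mathbf L_e$ and $\times_{pe},\ \amalg_{pe}$ on $\mathbf C_{pe}$ be the restrictions of the corresponding functors, and let $\multimap_e:\mathbf L_e\times\mathbf L_e\to\mathbf L_e$ send $(e_1,e_2)$ to $e_1^\bullet\multimap e_2$. Let $\beta^{pe}$ denote the restriction of the natural isomorphism $FX\otimes FY\cong F(X\times Y)$, respectively $FX+FY\cong F(X\amalg Y)$, to a natural isomorphism $\odot_e\circ(F_{pe}\times F_{pe})\Rightarrow F_{pe}\circ\boxdot_{pe}$, where $(\odot,\boxdot)$ is $(\otimes,\times)$, respectively $(+,\amalg)$. **Parameterised initial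 algebras.** Let $\mathbf A$ be a category and $\mathbf B$ an $\omega$-category. For an $\omega$-functor $T:\mathbf A\times\mathbf B\to\mathbf B$, let $T^\dagger:\mathbf A\to\mathbf B$ be given by $T^\dagger A=\mathrm{colim}\big(\varnothing\to T(A,\varnothing)\to T(A,T(A,\varnothing))\to\cdots\big)$, with the induced action on morphisms, and let $\phi^T:T\circ\langle\mathrm{Id},T^\dagger\rangle\Rightarrow T^\dagger$ be the natural isomorphism formed by the structure maps of the initial $T(A,-)$-algebras. Let $T:\mathbf C'\times\mathbf D\to\mathbf D$ and $H:\mathbf A\times\mathbf B\to\mathbf B$ be $\omega$-functors, where $\mathbf D$ is also an $\omega$-category, $N:\mathbf A\to\mathbf C'$ a functor, and $M:\mathbf B\to\mathbf D$ a strict $\omega$-functor. For a natural isomorphism $\alpha:T\circ(N\times M)\Rightarrow M\circ H$, let $\alpha^\dagger:T^\dagger\circ N\Rightarrow M\circ H^\dagger$ be the natural isomorphism whose component at $A$ is induced on colimits by $(\alpha^*_A)_0=(0\cong M\varnothing)$ and $(\alpha^*_A)_{n+1}=\alpha_{A,H(A,-)^n\varnothing}\circ T(NA,(\alpha^*_A)_n)$,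 using that $M$ preserves $\omega$-colimits. **Types.** Types are $A,B::=X\mid\ !A\mid A+B\mid A\otimes B\mid A\multimap B\mid\mu X.A$; non-linear types are $P,Q::=X\mid\ !A\mid P+Q\mid P\otimes Q\mid\mu X.P$ (with $A$ an arbitrary type). $\Theta\vdash A$ means that the free variables of $A$ are in the list $\Theta=\Theta_1,\dots,\Theta_{|\Theta|}$ of distinct variables; types are taken up to renaming of bound variables and $[B/X]$ is capture-avoiding substitution. The standard interpretation $[\![\Theta\vdash A]\!]:\mathbf L_e^{|\Theta|}\to\mathbf L_e$ is the $\omega$-functor given by $[\![\Theta_i]\!]=\Pi_i$, $[\![!A]\!]=\,!_e\circ[\![A]\!]$, $[\![A\star B]\!]=\star_e\circ\langle[\![A]\!],[\![B]\!]\rangle$ for $\star\in\{+,\otimes,\multimap\}$, and $[\![\Theta\vdash\mu X.A]\!]=[\![\Theta,X\vdash A]\!]^\dagger$. The non-linear interpretation $(\!|\Theta\vdash P|\!):\mathbf C_{pe}^{|\Theta|}\to\mathbf C_{pe}$ of a non-linear type is the $\omega$-functor given by $(\!|\Theta_i|\!)=\Pi_i$, $(\!|!A|\!)=G_{pe}\circ[\![A]\!]\circ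 F_{pe}^{\times|\Theta|}$, $(\!|P\odot Q|\!)=\boxdot_{pe}\circ\langle(\!|P|\!),(\!|Q|\!)\rangle$, and $(\!|\Theta\vdash\mu X.P|\!)=(\!|\Theta,X\vdash P|\!)^\dagger$. **Comparison isomorphisms.** For a non-linear type $\Theta\vdash P$, the natural isomorphism $\alpha^{\Theta\vdash P}:[\![\Theta\vdash P]\!]\circ F_{pe}^{\times|\Theta|}\Rightarrow F_{pe}\circ(\!|\Theta\vdash P|\!)$ is defined by $\alpha^{\Theta_i}=\mathrm{id}$, $\alpha^{!A}=\mathrm{id}$, $\alpha^{P\odot Q}=\beta^{pe}\langle(\!|P|\!),(\!|Q|\!)\rangle\circ\odot_e\langle\alpha^P,\alpha^Q\rangle$, and $\alpha^{\Theta\vdash\mu X.P}=(\alpha^{\Theta,X\vdash P})^\dagger$. One has $[\![\Theta\vdash A[B/X]]\!]=[\![\Theta,X\vdash A]\!]\circ\langle\mathrm{Id},[\![\Theta\vdash B]\!]\rangle$. For non-linear $\Theta,X\vdash P$ and $\Theta\vdash R$, the natural isomorphism $\gamma^{P[R/X]}:(\!|\Theta\vdash P[R/X]|\!)\Rightarrow(\!|\Theta,X\vdash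 P|\!)\circ\langle\mathrm{Id},(\!|\Theta\vdash R|\!)\rangle$ is defined by: $\gamma=\mathrm{id}$ if $P$ is a variable; $\gamma^{!A[R/X]}=G_{pe}[\![\Theta,X\vdash A]\!]\langle F_{pe}^{\times|\Theta|},\alpha^{\Theta\vdash R}\rangle$; $\gamma^{(P\odot Q)[R/X]}=\boxdot_{pe}\langle\gamma^{P[R/X]},\gamma^{Q[R/X]}\rangle$; $\gamma^{\Theta\vdash(\mu Y.P)[R/X]}=(\gamma^{\Theta,Y\vdash P[R/X]})^\dagger$ (with $N=\mathrm{Id}$ and $M=\mathrm{Id}$). **Folding.** For $\Theta,X\vdash A$, and for $\Theta,X\vdash P$ with $P$ non-linear, let $$\mathrm{fold}^{\Theta\vdash\mu X.A}=\Big([\![\Theta\vdash A[\mu X.A/X]]\!]=[\![\Theta,X\vdash A]\!]\circ\langle\mathrm{Id},[\![\Theta\vdash\mu X.A]\!]\rangle\overset{\phi}{\Longrightarrow}[\![\Theta\vdash\mu X.A]\!]\Big),$$ $$\mathit{fold}^{\Theta\vdash\mu X.P}=\Big((\!|\Theta\vdash P[\mu X.P/X]|\!)\overset{\gamma}{\Longrightarrow}(\!|\Theta,X\vdash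 P|\!)\circ\langle\mathrm{Id},(\!|\Theta\vdash\mu X.P|\!)\rangle\overset{\phi}{\Longrightarrow}(\!|\Theta\vdash\mu X.P|\!)\Big).$$ **Theorem.** In every $\mathbf{CPO}$-LNL model, for every non-linear type $\Theta\vdash\mu X.P$, $$F_{pe}\,\mathit{fold}^{\Theta\vdash\mu X.P}\circ\alpha^{\Theta\vdash P[\mu X.P/X]}\;=\;\alpha^{\Theta\vdash\mu X.P}\circ\mathrm{fold}^{\Theta\vdash\mu X.P}F_{pe}^{\times|\Theta|}$$ as natural isomorphisms $[\![\Theta\vdash P[\mu X.P/X]]\!]\circ F_{pe}^{\times|\Theta|}\Rightarrow F_{pe}\circ(\!|\Theta\vdash\mu X.P|\!):\mathbf C_{pe}^{|\Theta|}\to\mathbf L_e$. -/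

import Mathlib

open CategoryTheory CategoryTheory.Limits MonoidalCategory OmegaCompletePartialOrder

universe v₁ v₂ v₃ v₄ u₁ u₂ u₃ u₄

namespace LNLFPC

/-! ### Initial sequences and parameterised initial algebras in `ω`-categories -/

section OmegaCategories

variable {A : Type u₁} [Category.{v₁} A] {B : Type u₂} [Category.{v₂} B]
variable {A' : Type u₃} [Category.{v₃} A'] {D : Type u₄} [Category.{v₄} D]

/-- An `ω`-functor: a functor that preserves all existing colimits of `ω`-diagrams. -/
abbrev IsOmegaFunctor (T : A ⥤ B) : Prop := PreservesColimitsOfShape ℕ T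

section InitialSequence

variable [HasInitial B]

/-- `T ^ n ∅`. -/
noncomputable def iterObj (T : B ⥤ B) : ℕ → B
  | 0 => ⊥_ B
  | n + 1 => T.obj (iterObj T n)

/-- `T ^ n ι : T ^ n ∅ ⟶ T ^ (n + 1) ∅`. -/
noncomputable def iterStep (T : B ⥤ B) : ∀ n, iterObj T n ⟶ iterObj T (n + 1)
  | 0 => initial.to _
  | n + 1 => T.map (iterStep T n)

/-- The component at `∅` of the `n`-fold horizontal composition of `τ` with itself. -/
noncomputable def iterMap {T H : B ⥤ B} (τ : T ⟶ H) : ∀ n, iterObj T n ⟶ iterObj H n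
  | 0 => 𝟙 _
  | n + 1 => T.map (iterMap τ n) ≫ τ.app (iterObj H n)

theorem iterStep_naturality {T H : B ⥤ B} (τ : T ⟶ H) (n : ℕ) :
    iterStep T n ≫ iterMap τ (n + 1) = iterMap τ n ≫ iterStep H n := by
  induction n with
  | zero => exact initialIsInitial.hom_ext _ _
  | succ n ih =>
    change T.map (iterStep T n) ≫ T.map (iterMap τ (n + 1)) ≫ τ.app _ =
      (T.map (iterMap τ n) ≫ τ.app _) ≫ H.map (iterStep H n)
    rw [Category.assoc, ← τ.naturality, ← Functor.map_comp_assoc, ← Functor.map_comp_assoc, ih]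

variable (B) in
/-- The functor sending an endofunctor `T` to its initial sequence `∅ ⟶ T ∅ ⟶ T ^ 2 ∅ ⟶ ⋯`. -/
noncomputable def seqFunctor : (B ⥤ B) ⥤ (ℕ ⥤ B) where
  obj T := Functor.ofSequence (iterStep T)
  map {T H} τ := NatTrans.ofSequence (iterMap τ) (fun n => by
    rw [Functor.ofSequence_map_homOfLE_succ, Functor.ofSequence_map_homOfLE_succ]
    exact iterStep_naturality τ n)
  map_id T := by
    ext n
    change iterMap (𝟙 T) n = 𝟙 (iterObj T n)
    induction n with
    | zero => rfl
    | succ n ih =>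
      change T.map (iterMap (𝟙 T) n) ≫ 𝟙 (T.obj (iterObj T n)) = 𝟙 (T.obj (iterObj T n))
      rw [ih]; simp
  map_comp {T H K} τ σ := by
    ext n
    change iterMap (τ ≫ σ) n = iterMap τ n ≫ iterMap σ n
    induction n with
    | zero => exact (Category.id_comp _).symm
    | succ n ih =>
      change T.map (iterMap (τ ≫ σ) n) ≫ τ.app _ ≫ σ.app _ =
        (T.map (iterMap τ n) ≫ τ.app _) ≫ H.map (iterMap σ n) ≫ σ.app _
      rw [ih]; simp

variable [HasColimitsOfShape ℕ B]

variable (B) in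
/-- The functor sending an endofunctor to the colimit of its initial sequence, which is the
carrier of its initial algebra if the endofunctor is an `ω`-functor. -/
noncomputable def initAlg : (B ⥤ B) ⥤ B := seqFunctor B ⋙ colim

/-- The natural transformation from the initial sequence of `T` to its image under `T`. -/
noncomputable def seqShift (T : B ⥤ B) : (seqFunctor B).obj T ⟶ (seqFunctor B).obj T ⋙ T :=
  NatTrans.ofSequence (iterStep T) (fun n => by
    have h := Functor.ofSequence_map_homOfLE_succ (iterStep T) n
    exact (congrArg (· ≫ iterStep T (n + 1)) h).trans
      (congrArg (fun f => iterStep T n ≫ T.map f) h).symm)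

instance isIso_colimMap_seqShift (T : B ⥤ B) : IsIso (colimMap (seqShift T)) := by
  have hw (n : ℕ) : iterStep T n ≫ colimit.ι ((seqFunctor B).obj T) (n + 1) =
      colimit.ι ((seqFunctor B).obj T) n := by
    have := colimit.w ((seqFunctor B).obj T) (homOfLE (Nat.le_add_right n 1))
    rw [← this]
    congr 1
    exact (Functor.ofSequence_map_homOfLE_succ (iterStep T) n).symm
  let c : Cocone ((seqFunctor B).obj T ⋙ T) :=
    { pt := colimit ((seqFunctor B).obj T)
      ι := NatTrans.ofSequence (fun n => colimit.ι ((seqFunctor B).obj T) (n + 1)) (fun n => by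
        refine Eq.trans ?_ (Category.comp_id _).symm
        refine Eq.trans ?_ (hw (n + 1))
        congr 1
        exact congrArg T.map (Functor.ofSequence_map_homOfLE_succ (iterStep T) n)) }
  refine ⟨colimit.desc _ c, ?_, ?_⟩
  · refine colimit.hom_ext fun n => ?_
    rw [ι_colimMap_assoc, colimit.ι_desc, Category.comp_id]
    exact hw n
  · refine colimit.hom_ext fun n => ?_
    rw [colimit.ι_desc_assoc, Category.comp_id]
    refine (ι_colimMap (seqShift T) (n + 1)).trans ?_
    have := colimit.w ((seqFunctor B).obj T ⋙ T) (homOfLE (Nat.le_add_right n 1))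
    rw [← this]
    congr 1
    exact (congrArg T.map (Functor.ofSequence_map_homOfLE_succ (iterStep T) n)).symm

/-- The initial algebra structure `T (colim (S T)) = colim (T (S T)) ⟶ colim (S T)`, where the
second map is the inverse of the map induced by `seqShift T`. -/
noncomputable def initAlgIso (T : B ⥤ B) [IsOmegaFunctor T] :
    T.obj ((initAlg B).obj T) ≅ (initAlg B).obj T :=
  preservesColimitIso T ((seqFunctor B).obj T) ≪≫ (asIso (colimMap (seqShift T))).symm

/-- The colimit injection `T ^ n ∅ ⟶ colim (S T)`. -/
noncomputable def seqι (T : B ⥤ B) (n : ℕ) : iterObj T n ⟶ (initAlg B).obj T :=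
  colimit.ι ((seqFunctor B).obj T) n

theorem seqι_comp_map {T H : B ⥤ B} (τ : T ⟶ H) (n : ℕ) :
    seqι T n ≫ (initAlg B).map τ = iterMap τ n ≫ seqι H n :=
  ι_colimMap ((seqFunctor B).map τ) n

theorem map_initAlg_hom_ext (T : B ⥤ B) [IsOmegaFunctor T] {X : B}
    {f g : T.obj ((initAlg B).obj T) ⟶ X} (h : ∀ n, T.map (seqι T n) ≫ f = T.map (seqι T n) ≫ g) :
    f = g :=
  (isColimitOfPreserves T (colimit.isColimit ((seqFunctor B).obj T))).hom_ext h

theorem map_seqι_comp_initAlgIso_hom (T : B ⥤ B) [IsOmegaFunctor T] (n : ℕ) :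
    T.map (seqι T n) ≫ (initAlgIso T).hom = seqι T (n + 1) := by
  have h : colimit.ι ((seqFunctor B).obj T) (n + 1) ≫ colimMap (seqShift T) =
      colimit.ι ((seqFunctor B).obj T ⋙ T) n := by
    refine (ι_colimMap (seqShift T) (n + 1)).trans ?_
    have := colimit.w ((seqFunctor B).obj T ⋙ T) (homOfLE (Nat.le_add_right n 1))
    rw [← this]
    congr 1
    exact (congrArg T.map (Functor.ofSequence_map_homOfLE_succ (iterStep T) n)).symm
  refine Eq.trans (ι_preservesColimitIso_hom_assoc T ((seqFunctor B).obj T) n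
    (inv (colimMap (seqShift T)))) ?_
  exact (IsIso.comp_inv_eq (colimMap (seqShift T))).2 h.symm

theorem initAlgIso_naturality {T H : B ⥤ B} [IsOmegaFunctor T] [IsOmegaFunctor H] (τ : T ⟶ H) :
    (T.map ((initAlg B).map τ) ≫ τ.app _) ≫ (initAlgIso H).hom =
      (initAlgIso T).hom ≫ (initAlg B).map τ := by
  refine map_initAlg_hom_ext T fun n => ?_
  have h₁ : T.map (seqι T n) ≫ (T.map ((initAlg B).map τ) ≫ τ.app _) ≫ (initAlgIso H).hom =
      (T.map (iterMap τ n) ≫ τ.app (iterObj H n)) ≫ seqι H (n + 1) := by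
    rw [Category.assoc, ← T.map_comp_assoc, seqι_comp_map, T.map_comp_assoc, τ.naturality_assoc,
      map_seqι_comp_initAlgIso_hom]
    exact (Category.assoc _ _ _).symm
  have h₂ : T.map (seqι T n) ≫ (initAlgIso T).hom ≫ (initAlg B).map τ =
      iterMap τ (n + 1) ≫ seqι H (n + 1) := by
    rw [← seqι_comp_map, ← Category.assoc, map_seqι_comp_initAlgIso_hom]
    rfl
  exact h₁.trans h₂.symm

/-- The functor `T† : A ⥤ B` sending `a` to the carrier of the initial `T (a, -)`-algebra. -/
noncomputable def dagger (T : A × B ⥤ B) : A ⥤ B := Functor.curry.obj T ⋙ initAlg B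

/-- The action of `(-)†` on natural isomorphisms between functors `A × B ⥤ B`. -/
noncomputable def daggerMapIso {T H : A × B ⥤ B} (γ : T ≅ H) : dagger T ≅ dagger H :=
  Functor.isoWhiskerRight (Functor.curry.mapIso γ) (initAlg B)

end InitialSequence


/-! ### Products of categories and `ω`-functors -/

section Products

theorem isColimit_prod {K : ℕ ⥤ A × B} {c : Cocone K}
    (h₁ : Nonempty (IsColimit ((CategoryTheory.Prod.fst A B).mapCocone c)))
    (h₂ : Nonempty (IsColimit ((CategoryTheory.Prod.snd A B).mapCocone c))) : Nonempty (IsColimit c) := by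
  obtain ⟨h₁⟩ := h₁
  obtain ⟨h₂⟩ := h₂
  exact ⟨{
    desc := fun s => (h₁.desc ((CategoryTheory.Prod.fst A B).mapCocone s), h₂.desc ((CategoryTheory.Prod.snd A B).mapCocone s))
    fac := fun s n => Prod.ext (h₁.fac ((CategoryTheory.Prod.fst A B).mapCocone s) n)
      (h₂.fac ((CategoryTheory.Prod.snd A B).mapCocone s) n)
    uniq := fun s m w => Prod.ext
      (h₁.uniq ((CategoryTheory.Prod.fst A B).mapCocone s) m.1 fun n => congrArg Prod.fst (w n))
      (h₂.uniq ((CategoryTheory.Prod.snd A B).mapCocone s) m.2 fun n => congrArg Prod.snd (w n)) }⟩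

theorem isColimit_pi {I : Type} {K : ℕ ⥤ (I → A)} {c : Cocone K}
    (h : ∀ i, Nonempty (IsColimit ((Pi.eval (fun _ : I => A) i).mapCocone c))) :
    Nonempty (IsColimit c) := by
  have h := fun i => (h i).some
  exact ⟨{
    desc := fun s i => (h i).desc ((Pi.eval (fun _ : I => A) i).mapCocone s)
    fac := fun s n => funext fun i => (h i).fac ((Pi.eval (fun _ : I => A) i).mapCocone s) n
    uniq := fun s m w => funext fun i =>
      (h i).uniq ((Pi.eval (fun _ : I => A) i).mapCocone s) (m i) fun n => congrFun (w n) i }⟩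

instance isOmegaFunctor_prod' (F : D ⥤ A) (G : D ⥤ B) [IsOmegaFunctor F] [IsOmegaFunctor G] :
    IsOmegaFunctor (F.prod' G) :=
  ⟨⟨fun hc => isColimit_prod ⟨isColimitOfPreserves F hc⟩ ⟨isColimitOfPreserves G hc⟩⟩⟩

theorem isOmegaFunctor_pi' {I : Type} (F : I → D ⥤ A) (h : ∀ i, IsOmegaFunctor (F i)) :
    IsOmegaFunctor (Functor.pi' F) :=
  ⟨⟨fun hc => isColimit_pi fun i => ⟨isColimitOfPreserves (F i) hc⟩⟩⟩

instance isOmegaFunctor_fst [HasColimitsOfShape ℕ A] [HasColimitsOfShape ℕ B] :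
    IsOmegaFunctor (CategoryTheory.Prod.fst A B) where
  preservesColimit {K} := by
    let c : Cocone K :=
      { pt := (colimit (K ⋙ CategoryTheory.Prod.fst A B), colimit (K ⋙ CategoryTheory.Prod.snd A B))
        ι :=
          { app := fun n => (colimit.ι (K ⋙ CategoryTheory.Prod.fst A B) n, colimit.ι (K ⋙ CategoryTheory.Prod.snd A B) n)
            naturality := fun n m f => Prod.ext
              ((colimit.cocone (K ⋙ CategoryTheory.Prod.fst A B)).ι.naturality f)
              ((colimit.cocone (K ⋙ CategoryTheory.Prod.snd A B)).ι.naturality f) } }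
    obtain ⟨hc⟩ := isColimit_prod (c := c) ⟨colimit.isColimit (K ⋙ CategoryTheory.Prod.fst A B)⟩
      ⟨colimit.isColimit (K ⋙ CategoryTheory.Prod.snd A B)⟩
    exact preservesColimit_of_preserves_colimit_cocone hc (colimit.isColimit (K ⋙ CategoryTheory.Prod.fst A B))

instance isOmegaFunctor_snd [HasColimitsOfShape ℕ A] [HasColimitsOfShape ℕ B] :
    IsOmegaFunctor (CategoryTheory.Prod.snd A B) where
  preservesColimit {K} := by
    let c : Cocone K :=
      { pt := (colimit (K ⋙ CategoryTheory.Prod.fst A B), colimit (K ⋙ CategoryTheory.Prod.snd A B))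
        ι :=
          { app := fun n => (colimit.ι (K ⋙ CategoryTheory.Prod.fst A B) n, colimit.ι (K ⋙ CategoryTheory.Prod.snd A B) n)
            naturality := fun n m f => Prod.ext
              ((colimit.cocone (K ⋙ CategoryTheory.Prod.fst A B)).ι.naturality f)
              ((colimit.cocone (K ⋙ CategoryTheory.Prod.snd A B)).ι.naturality f) } }
    obtain ⟨hc⟩ := isColimit_prod (c := c) ⟨colimit.isColimit (K ⋙ CategoryTheory.Prod.fst A B)⟩
      ⟨colimit.isColimit (K ⋙ CategoryTheory.Prod.snd A B)⟩
    exact preservesColimit_of_preserves_colimit_cocone hc (colimit.isColimit (K ⋙ CategoryTheory.Prod.snd A B))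

instance isOmegaFunctor_eval {I : Type} [HasColimitsOfShape ℕ A] (i : I) :
    IsOmegaFunctor (Pi.eval (fun _ : I => A) i) where
  preservesColimit {K} := by
    let c : Cocone K :=
      { pt := fun i => colimit (K ⋙ Pi.eval (fun _ : I => A) i)
        ι :=
          { app := fun n i => colimit.ι (K ⋙ Pi.eval (fun _ : I => A) i) n
            naturality := fun n m f => funext fun i =>
              (colimit.cocone (K ⋙ Pi.eval (fun _ : I => A) i)).ι.naturality f } }
    obtain ⟨hc⟩ := isColimit_pi (c := c) fun i =>
      ⟨colimit.isColimit (K ⋙ Pi.eval (fun _ : I => A) i)⟩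
    exact preservesColimit_of_preserves_colimit_cocone hc
      (colimit.isColimit (K ⋙ Pi.eval (fun _ : I => A) i))

theorem isOmegaFunctor_const (b : B) : IsOmegaFunctor ((Functor.const A).obj b) where
  preservesColimit {_} :=
    ⟨fun _ => ⟨(isColimitConstCocone ℕ b).ofIsoColimit
      (Cocone.ext (Iso.refl _) (fun _ => Category.comp_id _))⟩⟩

instance isOmegaFunctor_partial {E : Type*} [Category* E] (T : A × B ⥤ E) [IsOmegaFunctor T]
    (a : A) : IsOmegaFunctor ((Functor.curry.obj T).obj a) := by
  have := isOmegaFunctor_const (A := B) a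
  have h : IsOmegaFunctor (((Functor.const B).obj a).prod' (𝟭 B) ⋙ T) := inferInstance
  exact h

end Products

section Dagger

variable [HasInitial B] [HasColimitsOfShape ℕ B]

theorem isOmegaFunctor_dagger (T : A × B ⥤ B) [IsOmegaFunctor T] :
    IsOmegaFunctor (dagger T) := by
  have h : ∀ n : ℕ, IsOmegaFunctor
      ((Functor.curry.obj T ⋙ seqFunctor B) ⋙ (evaluation ℕ B).obj n) := by
    intro n
    induction n with
    | zero =>
      have := isOmegaFunctor_const (A := A) (⊥_ B)
      exact preservesColimitsOfShape_of_natIso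
        (NatIso.ofComponents (fun _ => Iso.refl _) (fun _ => rfl) :
          (Functor.const A).obj (⊥_ B) ≅ _)
    | succ n ih =>
      let e : (𝟭 A).prod' ((Functor.curry.obj T ⋙ seqFunctor B) ⋙ (evaluation ℕ B).obj n) ⋙ T ≅
          (Functor.curry.obj T ⋙ seqFunctor B) ⋙ (evaluation ℕ B).obj (n + 1) :=
        NatIso.ofComponents
          (fun a => Iso.refl (T.obj (a, iterObj ((Functor.curry.obj T).obj a) n))) (by
            intro X Y f
            refine (Category.comp_id _).trans (Eq.trans ?_ (Category.id_comp _).symm)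
            refine Eq.trans ?_ (T.map_comp (X := (X, _)) (Y := (X, _)) (Z := (Y, _))
              (𝟙 X, iterMap ((Functor.curry.obj T).map f) n) (f, 𝟙 _))
            refine congrArg T.map (Prod.ext ?_ ?_)
            · exact (Category.id_comp f).symm
            · exact (Category.comp_id _).symm)
      exact preservesColimitsOfShape_of_natIso e
  have : IsOmegaFunctor (Functor.curry.obj T ⋙ seqFunctor B) :=
    preservesColimitsOfShape_of_evaluation _ _ h
  have h' : IsOmegaFunctor ((Functor.curry.obj T ⋙ seqFunctor B) ⋙ colim) := inferInstance
  exact h'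

/-- The natural isomorphism `T ∘ ⟨Id, T†⟩ ≅ T†` whose component at `a` is the structure map of
the initial `T (a, -)`-algebra. -/
noncomputable def daggerIso (T : A × B ⥤ B) [IsOmegaFunctor T] :
    (𝟭 A).prod' (dagger T) ⋙ T ≅ dagger T :=
  NatIso.ofComponents (fun a => initAlgIso ((Functor.curry.obj T).obj a)) (by
    intro X Y f
    refine Eq.trans (congrArg (· ≫ _) ?_) (initAlgIso_naturality ((Functor.curry.obj T).map f))
    refine Eq.trans (congrArg T.map (Prod.ext ?_ ?_)) (T.map_comp (X := (X, _)) (Y := (X, _))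
      (Z := (Y, _)) (𝟙 X, (initAlg B).map ((Functor.curry.obj T).map f)) (f, 𝟙 _))
    · exact (Category.id_comp f).symm
    · exact (Category.comp_id _).symm)

theorem dagger_comp (H : A' ⥤ A) (T : A × B ⥤ B) :
    dagger (H.prod (𝟭 B) ⋙ T) = H ⋙ dagger T := by
  have h : Functor.curry.obj (H.prod (𝟭 B) ⋙ T) = H ⋙ Functor.curry.obj T := by
    refine CategoryTheory.Functor.ext (fun a => CategoryTheory.Functor.ext (fun b => rfl) ?_) ?_
    · intro X Y f
      simp
    · intro X Y f
      ext b
      simp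
  unfold dagger
  rw [h]
  rfl

end Dagger

/-! ### Relating parameterised initial algebras in different categories -/

section Mediation

variable {C : Type u₃} [Category.{v₃} C]
variable {N : A ⥤ C} {M : B ⥤ D} {T : C × D ⥤ D} {H : A × B ⥤ B}

/-- The component `T (N a, M b) ≅ M (H (a, b))` of `α`. -/
def squareApp (α : N.prod M ⋙ T ≅ H ⋙ M) (a : A) (b : B) :
    ((Functor.curry.obj T).obj (N.obj a)).obj (M.obj b) ≅
      M.obj (((Functor.curry.obj H).obj a).obj b) :=
  α.app (a, b)

theorem squareApp_naturality_right (α : N.prod M ⋙ T ≅ H ⋙ M) (a : A) {b b' : B} (g : b ⟶ b') :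
    ((Functor.curry.obj T).obj (N.obj a)).map (M.map g) ≫ (squareApp α a b').hom =
      (squareApp α a b).hom ≫ M.map (((Functor.curry.obj H).obj a).map g) := by
  have h := α.hom.naturality (X := (a, b)) (Y := (a, b')) (𝟙 a, g)
  refine Eq.trans (congrArg (fun k => T.map k ≫ α.hom.app (a, b')) (Prod.ext ?_ ?_)) h
  · exact (N.map_id a).symm
  · rfl

theorem squareApp_naturality_left (α : N.prod M ⋙ T ≅ H ⋙ M) {a a' : A} (f : a ⟶ a') (b : B) :
    ((Functor.curry.obj T).map (N.map f)).app (M.obj b) ≫ (squareApp α a' b).hom =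
      (squareApp α a b).hom ≫ M.map (((Functor.curry.obj H).map f).app b) := by
  have h := α.hom.naturality (X := (a, b)) (Y := (a', b)) (f, 𝟙 b)
  refine Eq.trans (congrArg (fun k => T.map k ≫ α.hom.app (a', b)) (Prod.ext ?_ ?_)) h
  · rfl
  · exact (M.map_id b).symm

variable [HasInitial B] [HasInitial D] [PreservesColimit (Functor.empty.{0} B) M]

/-- The components of `α*`. -/
noncomputable def starApp (α : N.prod M ⋙ T ≅ H ⋙ M) (a : A) :
    ∀ n, iterObj ((Functor.curry.obj T).obj (N.obj a)) n ≅
      M.obj (iterObj ((Functor.curry.obj H).obj a) n)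
  | 0 => initialIsInitial.uniqueUpToIso (IsInitial.isInitialObj M _ initialIsInitial)
  | n + 1 => ((Functor.curry.obj T).obj (N.obj a)).mapIso (starApp α a n) ≪≫
      squareApp α a (iterObj ((Functor.curry.obj H).obj a) n)

theorem starApp_naturality_nat (α : N.prod M ⋙ T ≅ H ⋙ M) (a : A) (n : ℕ) :
    iterStep ((Functor.curry.obj T).obj (N.obj a)) n ≫ (starApp α a (n + 1)).hom =
      (starApp α a n).hom ≫ M.map (iterStep ((Functor.curry.obj H).obj a) n) := by
  induction n with
  | zero => exact initialIsInitial.hom_ext _ _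
  | succ n ih =>
    change ((Functor.curry.obj T).obj (N.obj a)).map _ ≫
      ((Functor.curry.obj T).obj (N.obj a)).map (starApp α a (n + 1)).hom ≫
        (squareApp α a _).hom =
      (((Functor.curry.obj T).obj (N.obj a)).map (starApp α a n).hom ≫ (squareApp α a _).hom) ≫
        M.map (((Functor.curry.obj H).obj a).map (iterStep ((Functor.curry.obj H).obj a) n))
    rw [Category.assoc, ← squareApp_naturality_right, ← Functor.map_comp_assoc, ih,
      Functor.map_comp_assoc]

theorem starApp_naturality (α : N.prod M ⋙ T ≅ H ⋙ M) {a b : A} (f : a ⟶ b) (n : ℕ) :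
    iterMap ((Functor.curry.obj T).map (N.map f)) n ≫ (starApp α b n).hom =
      (starApp α a n).hom ≫ M.map (iterMap ((Functor.curry.obj H).map f) n) := by
  induction n with
  | zero => exact initialIsInitial.hom_ext _ _
  | succ n ih =>
    change (((Functor.curry.obj T).obj (N.obj a)).map (iterMap _ n) ≫
        ((Functor.curry.obj T).map (N.map f)).app _) ≫
      ((Functor.curry.obj T).obj (N.obj b)).map (starApp α b n).hom ≫ (squareApp α b _).hom =
      (((Functor.curry.obj T).obj (N.obj a)).map (starApp α a n).hom ≫ (squareApp α a _).hom) ≫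
        M.map (((Functor.curry.obj H).obj a).map (iterMap _ n) ≫
          ((Functor.curry.obj H).map f).app _)
    rw [Category.assoc, ← NatTrans.naturality_assoc, ← Functor.map_comp_assoc, ih,
      Functor.map_comp_assoc, squareApp_naturality_left, Functor.map_comp, Category.assoc,
      ← reassoc_of% (squareApp_naturality_right α a)]

/-- The natural isomorphism `α* : T* ∘ N ≅ (M ▹ -) ∘ H*`. -/
noncomputable def starIso (α : N.prod M ⋙ T ≅ H ⋙ M) :
    N ⋙ Functor.curry.obj T ⋙ seqFunctor D ≅
      (Functor.curry.obj H ⋙ seqFunctor B) ⋙ (Functor.whiskeringRight ℕ B D).obj M :=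
  NatIso.ofComponents
    (fun a => NatIso.ofComponents (starApp α a) (fun {n m} f =>
      (NatTrans.ofSequence
        (F := Functor.ofSequence (iterStep ((Functor.curry.obj T).obj (N.obj a))))
        (G := Functor.ofSequence (iterStep ((Functor.curry.obj H).obj a)) ⋙ M)
        (fun n => (starApp α a n).hom)
        (fun n => by
          refine Eq.trans ?_ ((starApp_naturality_nat α a n).trans ?_)
          · exact congrArg (· ≫ (starApp α a (n + 1)).hom)
              (Functor.ofSequence_map_homOfLE_succ _ n)
          · exact (congrArg (fun k => (starApp α a n).hom ≫ M.map k)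
              (Functor.ofSequence_map_homOfLE_succ _ n)).symm)).naturality f))
    (fun {a b} f => by
      ext n
      exact starApp_naturality α f n)

variable [HasColimitsOfShape ℕ B] [HasColimitsOfShape ℕ D]

/-- The natural isomorphism `α† : T† ∘ N ≅ M ∘ H†`. -/
noncomputable def daggerSquareIso [IsOmegaFunctor M] (α : N.prod M ⋙ T ≅ H ⋙ M) :
    N ⋙ dagger T ≅ dagger H ⋙ M :=
  Functor.isoWhiskerRight (starIso α) colim ≪≫
    Functor.isoWhiskerLeft (Functor.curry.obj H ⋙ seqFunctor B) (preservesColimitNatIso M).symm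

end Mediation

end OmegaCategories
/-! ### Categories enriched over cpo's and embedding-projection pairs -/

/-- A `CPO`-category: every homset carries the structure of a cpo (a poset with suprema of
increasing chains), and composition is Scott continuous. -/
class CPOCategory (C : Type u₁) [Category.{v₁} C] where
  homCPO : ∀ X Y : C, OmegaCompletePartialOrder (X ⟶ Y)
  comp_continuous : ∀ X Y Z : C,
    ωScottContinuous (fun p : (X ⟶ Y) × (Y ⟶ Z) => p.1 ≫ p.2)

attribute [reducible, instance] CPOCategory.homCPO

section CPO

variable {A : Type u₁} [Category.{v₁} A] [CPOCategory A]
variable {B : Type u₂} [Category.{v₂} B] [CPOCategory B]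
variable {C : Type u₃} [Category.{v₃} C] [CPOCategory C]

/-- A `CPO`-functor: a functor that is Scott continuous on hom-cpo's. -/
class IsCPOFunctor (T : A ⥤ C) : Prop where
  map_continuous : ∀ X Y : A, ωScottContinuous (fun f : X ⟶ Y => T.map f)

/-- A `CPO`-functor `A × B ⥤ C`. -/
class IsCPOBifunctor (T : A × B ⥤ C) : Prop where
  map_continuous : ∀ (X X' : A) (Y Y' : B),
    ωScottContinuous (fun p : (X ⟶ X') × (Y ⟶ Y') => T.map (Prod.mkHom p.1 p.2))

/-- A `CPO`-functor `Aᵒᵖ × B ⥤ C`. -/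
class IsCPOMixedBifunctor (T : Aᵒᵖ × B ⥤ C) : Prop where
  map_continuous : ∀ (X X' : A) (Y Y' : B),
    ωScottContinuous (fun p : (X' ⟶ X) × (Y ⟶ Y') => T.map (Prod.mkHom p.1.op p.2))

variable (C) in
/-- The morphisms that are embeddings, i.e. the embedding part of an embedding-projection pair. -/
def embeddings : MorphismProperty C := fun X Y e =>
  ∃ p : Y ⟶ X, e ≫ p = 𝟙 X ∧ p ≫ e ≤ 𝟙 Y

theorem comp_le_comp {X Y Z : C} {f f' : X ⟶ Y} {g g' : Y ⟶ Z} (hf : f ≤ f') (hg : g ≤ g') :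
    f ≫ g ≤ f' ≫ g' :=
  (CPOCategory.comp_continuous X Y Z).monotone (a := (f, g)) (b := (f', g')) ⟨hf, hg⟩

theorem embeddings_of_iso {X Y : C} (e : X ≅ Y) : embeddings C e.hom :=
  ⟨e.inv, e.hom_inv_id, e.inv_hom_id.le⟩

instance : (embeddings C).IsMultiplicative where
  id_mem X := embeddings_of_iso (Iso.refl X)
  comp_mem := by
    rintro X Y Z e e' ⟨p, h₁, h₂⟩ ⟨p', h₁', h₂'⟩
    refine ⟨p' ≫ p, ?_, ?_⟩
    · rw [Category.assoc, reassoc_of% h₁', h₁]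
    · calc (p' ≫ p) ≫ e ≫ e' = p' ≫ (p ≫ e) ≫ e' := by simp
        _ ≤ p' ≫ 𝟙 _ ≫ e' := comp_le_comp le_rfl (comp_le_comp h₂ le_rfl)
        _ ≤ 𝟙 _ := by simpa using h₂'

/-- The projection counterpart of an embedding. -/
noncomputable def proj {X Y : C} {e : X ⟶ Y} (he : embeddings C e) : Y ⟶ X := he.choose

theorem comp_proj {X Y : C} {e : X ⟶ Y} (he : embeddings C e) : e ≫ proj he = 𝟙 X :=
  he.choose_spec.1

theorem proj_comp {X Y : C} {e : X ⟶ Y} (he : embeddings C e) : proj he ≫ e ≤ 𝟙 Y :=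
  he.choose_spec.2

theorem eq_proj {X Y : C} {e : X ⟶ Y} (he : embeddings C e) {p : Y ⟶ X} (h₁ : e ≫ p = 𝟙 X)
    (h₂ : p ≫ e ≤ 𝟙 Y) : p = proj he := by
  apply le_antisymm
  · calc p = p ≫ e ≫ proj he := by rw [comp_proj, Category.comp_id]
      _ = (p ≫ e) ≫ proj he := (Category.assoc _ _ _).symm
      _ ≤ 𝟙 Y ≫ proj he := comp_le_comp h₂ le_rfl
      _ = proj he := Category.id_comp _
  · calc proj he = proj he ≫ e ≫ p := by rw [h₁, Category.comp_id]
      _ = (proj he ≫ e) ≫ p := (Category.assoc _ _ _).symm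
      _ ≤ 𝟙 Y ≫ p := comp_le_comp (proj_comp he) le_rfl
      _ = p := Category.id_comp _

theorem proj_id (X : C) (h : embeddings C (𝟙 X)) : proj h = 𝟙 X :=
  (eq_proj h (Category.comp_id _) (Category.comp_id _).le).symm

theorem proj_comp_eq {X Y Z : C} {e : X ⟶ Y} {e' : Y ⟶ Z} (he : embeddings C e)
    (he' : embeddings C e') (h : embeddings C (e ≫ e')) : proj h = proj he' ≫ proj he := by
  refine (eq_proj h ?_ ?_).symm
  · rw [Category.assoc, reassoc_of% (comp_proj he'), comp_proj]
  · calc (proj he' ≫ proj he) ≫ e ≫ e' = proj he' ≫ (proj he ≫ e) ≫ e' := by simp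
      _ ≤ proj he' ≫ 𝟙 _ ≫ e' := comp_le_comp le_rfl (comp_le_comp (proj_comp he) le_rfl)
      _ ≤ 𝟙 _ := by simpa using proj_comp he'

variable (C) in
/-- The wide subcategory `C_e` of embeddings. -/
abbrev Emb : Type u₃ := WideSubcategory (embeddings C)

section LimitColimit

theorem isLUB_range_const {α : Type*} [PartialOrder α] (a : α) :
    IsLUB (Set.range fun _ : ℕ => a) a :=
  ⟨by rintro _ ⟨_, rfl⟩; exact le_rfl, fun _ hx => hx ⟨0, rfl⟩⟩

theorem isLUB_comp {X Y Z : C} {c : ℕ → (X ⟶ Y)} (hc : Monotone c) {a : X ⟶ Y}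
    (h : IsLUB (Set.range c) a) (g : Y ⟶ Z) : IsLUB (Set.range fun n => c n ≫ g) (a ≫ g) := by
  let d : Chain ((X ⟶ Y) × (Y ⟶ Z)) :=
    Chain.zip ⟨⟨c, hc⟩⟩ ⟨⟨fun _ => g, monotone_const⟩⟩
  have h₁ : ωSup d = (a, g) := by
    refine Prod.ext ?_ ?_
    · exact (ωSup_eq_of_isLUB (c := ⟨⟨c, hc⟩⟩) h).symm
    · exact (ωSup_eq_of_isLUB (c := ⟨⟨fun _ => g, monotone_const⟩⟩) (isLUB_range_const g)).symm
  have h₂ := (CPOCategory.comp_continuous X Y Z).isLUB (c := d)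
  rw [h₁] at h₂
  exact h₂

theorem isLUB_comp' {X Y Z : C} (f : X ⟶ Y) {c : ℕ → (Y ⟶ Z)} (hc : Monotone c) {a : Y ⟶ Z}
    (h : IsLUB (Set.range c) a) : IsLUB (Set.range fun n => f ≫ c n) (f ≫ a) := by
  let d : Chain ((X ⟶ Y) × (Y ⟶ Z)) :=
    Chain.zip ⟨⟨fun _ => f, monotone_const⟩⟩ ⟨⟨c, hc⟩⟩
  have h₁ : ωSup d = (f, a) := by
    refine Prod.ext ?_ ?_
    · exact (ωSup_eq_of_isLUB (c := ⟨⟨fun _ => f, monotone_const⟩⟩) (isLUB_range_const f)).symm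
    · exact (ωSup_eq_of_isLUB (c := ⟨⟨c, hc⟩⟩) h).symm
  have h₂ := (CPOCategory.comp_continuous X Y Z).isLUB (c := d)
  rw [h₁] at h₂
  exact h₂

theorem eq_of_isLUB_of_eventually {α : Type*} [PartialOrder α] {c : ℕ → α} (hc : Monotone c)
    {a b : α} (h : IsLUB (Set.range c) a) (m : ℕ) (hm : ∀ n, m ≤ n → c n = b) : a = b := by
  refine h.unique ⟨?_, fun x hx => ?_⟩
  · rintro _ ⟨n, rfl⟩
    rw [← hm (max m n) (le_max_left _ _)]
    exact hc (le_max_right _ _)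
  · rw [← hm m le_rfl]
    exact hx ⟨m, rfl⟩

variable {K : ℕ ⥤ C}

/-- The cocone `c` consists of embeddings and the induced idempotents have supremum `𝟙`. -/
def HasEPSup (c : Cocone K) : Prop :=
  ∃ p : ∀ n, c.pt ⟶ K.obj n, (∀ n, c.ι.app n ≫ p n = 𝟙 _) ∧ (∀ n, p n ≫ c.ι.app n ≤ 𝟙 _) ∧
    IsLUB (Set.range fun n => p n ≫ c.ι.app n) (𝟙 c.pt)

theorem proj_step {c : Cocone K} {p : ∀ n, c.pt ⟶ K.obj n} (h₁ : ∀ n, c.ι.app n ≫ p n = 𝟙 _)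
    (h₂ : ∀ n, p n ≫ c.ι.app n ≤ 𝟙 _) {n m : ℕ} (f : n ⟶ m) : p n ≫ K.map f ≤ p m := by
  calc p n ≫ K.map f = p n ≫ K.map f ≫ c.ι.app m ≫ p m := by rw [h₁, Category.comp_id]
    _ = (p n ≫ c.ι.app n) ≫ p m := by rw [c.w_assoc, Category.assoc]
    _ ≤ 𝟙 _ ≫ p m := comp_le_comp (h₂ n) le_rfl
    _ = p m := Category.id_comp _

theorem monotone_proj_comp {c : Cocone K} {p : ∀ n, c.pt ⟶ K.obj n}
    (h₁ : ∀ n, c.ι.app n ≫ p n = 𝟙 _) (h₂ : ∀ n, p n ≫ c.ι.app n ≤ 𝟙 _) (s : Cocone K) :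
    Monotone (fun n => p n ≫ s.ι.app n) := by
  intro n m hnm
  change p n ≫ s.ι.app n ≤ p m ≫ s.ι.app m
  rw [← s.w (homOfLE hnm), ← Category.assoc]
  exact comp_le_comp (proj_step h₁ h₂ _) le_rfl

theorem HasEPSup.isColimit {c : Cocone K} (h : HasEPSup c) : Nonempty (IsColimit c) := by
  obtain ⟨p, h₁, h₂, h₃⟩ := h
  have hs (s : Cocone K) := monotone_proj_comp h₁ h₂ s
  let d (s : Cocone K) : Chain (c.pt ⟶ s.pt) := ⟨⟨_, hs s⟩⟩
  refine ⟨{ desc := fun s => ωSup (d s), fac := fun s m => ?_, uniq := fun s g w => ?_ }⟩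
  · refine eq_of_isLUB_of_eventually ?_
      (isLUB_comp' (c.ι.app m) (hs s) (isLUB_range_ωSup (d s))) m fun n hmn => ?_
    · exact fun a b hab => comp_le_comp le_rfl (hs s hab)
    · rw [← c.w (homOfLE hmn), Category.assoc, reassoc_of% (h₁ n), s.w]
  · have h := isLUB_comp (monotone_proj_comp h₁ h₂ c) h₃ g
    rw [Category.id_comp] at h
    refine ωSup_eq_of_isLUB (c := d s) ?_
    convert h using 3 with n
    change p n ≫ s.ι.app n = _
    rw [Category.assoc, w]

/-- The morphisms `K m ⟶ K n`, for arbitrary `m` and `n`, given by a diagram of embeddings and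
by its projections. -/
noncomputable def zigzag (hK : ∀ {m n : ℕ} (f : m ⟶ n), embeddings C (K.map f)) (m n : ℕ) :
    K.obj m ⟶ K.obj n :=
  if h : m ≤ n then K.map (homOfLE h) else proj (hK (homOfLE (le_of_not_ge h)))

theorem zigzag_comp (hK : ∀ {m n : ℕ} (f : m ⟶ n), embeddings C (K.map f)) {m m' : ℕ}
    (f : m ⟶ m') (n : ℕ) : K.map f ≫ zigzag hK m' n = zigzag hK m n := by
  unfold zigzag
  by_cases h' : m' ≤ n
  · rw [dif_pos h', dif_pos ((leOfHom f).trans h'), ← K.map_comp]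
    rfl
  · rw [dif_neg h']
    by_cases h : m ≤ n
    · rw [dif_pos h]
      have e : f = homOfLE h ≫ homOfLE (le_of_not_ge h') := rfl
      rw [e, K.map_comp, Category.assoc, comp_proj, Category.comp_id]
    · rw [dif_neg h]
      have e := proj_comp_eq (hK (homOfLE (le_of_not_ge h))) (hK f)
        (by rw [← K.map_comp]; exact hK _)
      have e' : proj (hK (homOfLE (le_of_not_ge h'))) =
          proj (hK f) ≫ proj (hK (homOfLE (le_of_not_ge h))) := by
        rw [← e]; congr 1; rw [← K.map_comp]; rfl
      rw [e', reassoc_of% (comp_proj (hK f))]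

theorem zigzag_comp_proj (hK : ∀ {m n : ℕ} (f : m ⟶ n), embeddings C (K.map f)) (m : ℕ)
    {n n' : ℕ} (f : n ⟶ n') : zigzag hK m n' ≫ proj (hK f) = zigzag hK m n := by
  unfold zigzag
  by_cases h : m ≤ n
  · rw [dif_pos h, dif_pos (h.trans (leOfHom f))]
    have e : homOfLE (h.trans (leOfHom f)) = homOfLE h ≫ f := rfl
    rw [e, K.map_comp, Category.assoc, comp_proj, Category.comp_id]
  · rw [dif_neg h]
    by_cases h' : m ≤ n'
    · rw [dif_pos h']
      have e := proj_comp_eq (hK (homOfLE (le_of_not_ge h))) (hK (homOfLE h'))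
        (by rw [← K.map_comp]; exact hK _)
      have e' : proj (hK f) =
          proj (hK (homOfLE h')) ≫ proj (hK (homOfLE (le_of_not_ge h))) := by
        rw [← e]; congr 1; rw [← K.map_comp]; rfl
      rw [e', reassoc_of% (comp_proj (hK (homOfLE h')))]
    · rw [dif_neg h']
      have e := proj_comp_eq (hK f) (hK (homOfLE (le_of_not_ge h')))
        (by rw [← K.map_comp]; exact hK _)
      rw [← e]; congr 1; rw [← K.map_comp]; rfl

theorem hasEPSup_of_isColimit (hK : ∀ {m n : ℕ} (f : m ⟶ n), embeddings C (K.map f))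
    {c : Cocone K} (hc : IsColimit c) : HasEPSup c := by
  let z (n : ℕ) : Cocone K :=
    { pt := K.obj n
      ι := { app := fun m => zigzag hK m n
             naturality := fun m m' f => (zigzag_comp hK f n).trans (Category.comp_id _).symm } }
  let p (n : ℕ) : c.pt ⟶ K.obj n := hc.desc (z n)
  have hp (m n : ℕ) : c.ι.app m ≫ p n = zigzag hK m n := hc.fac (z n) m
  have hz (m n : ℕ) (h : m ≤ n) : zigzag hK m n = K.map (homOfLE h) := dif_pos h
  have h₁ (n : ℕ) : c.ι.app n ≫ p n = 𝟙 _ := by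
    rw [hp, hz n n le_rfl]; exact K.map_id n
  have hpp (n m : ℕ) (f : n ⟶ m) : p m ≫ proj (hK f) = p n := by
    refine hc.hom_ext fun k => ?_
    rw [← Category.assoc, hp, hp, zigzag_comp_proj]
  have hm : Monotone (fun n => p n ≫ c.ι.app n) := by
    intro n m hnm
    change p n ≫ c.ι.app n ≤ p m ≫ c.ι.app m
    rw [← hpp n m (homOfLE hnm), ← c.w (homOfLE hnm)]
    calc (p m ≫ proj (hK (homOfLE hnm))) ≫ K.map (homOfLE hnm) ≫ c.ι.app m
        = p m ≫ (proj (hK (homOfLE hnm)) ≫ K.map (homOfLE hnm)) ≫ c.ι.app m := by simp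
      _ ≤ p m ≫ 𝟙 _ ≫ c.ι.app m :=
        comp_le_comp le_rfl (comp_le_comp (proj_comp _) le_rfl)
      _ = p m ≫ c.ι.app m := by simp
  have hl := isLUB_range_ωSup (⟨⟨_, hm⟩⟩ : Chain (c.pt ⟶ c.pt))
  have he : ωSup (⟨⟨_, hm⟩⟩ : Chain (c.pt ⟶ c.pt)) = 𝟙 c.pt := by
    refine hc.hom_ext fun m => ?_
    refine eq_of_isLUB_of_eventually ?_ (isLUB_comp' (c.ι.app m) hm hl) m fun n hmn => ?_
    · exact fun a b hab => comp_le_comp le_rfl (hm hab)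
    · rw [← Category.assoc, hp, hz m n hmn, c.w, Category.comp_id]
  rw [he] at hl
  exact ⟨p, h₁, fun n => hl.1 ⟨n, rfl⟩, hl⟩

/-- A morphism out of a colimit of embeddings is an embedding if its composites with the
colimit injections are embeddings. -/
theorem embeddings_desc {c : Cocone K} (h : HasEPSup c) {Y : C} (f : c.pt ⟶ Y)
    (hf : ∀ n, embeddings C (c.ι.app n ≫ f)) : embeddings C f := by
  obtain ⟨p, h₁, h₂, h₃⟩ := h
  have hq (n : ℕ) : proj (hf n) ≫ c.ι.app n ≫ f ≤ 𝟙 _ := proj_comp (hf n)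
  let s : Cocone K := { pt := Y, ι := { app := fun n => c.ι.app n ≫ f, naturality := by simp } }
  have hm := monotone_proj_comp (c := s) (p := fun n => proj (hf n))
    (fun n => comp_proj (hf n)) hq c
  have hl := isLUB_range_ωSup (⟨⟨_, hm⟩⟩ : Chain (Y ⟶ c.pt))
  obtain ⟨hcc⟩ := HasEPSup.isColimit ⟨p, h₁, h₂, h₃⟩
  refine ⟨ωSup (⟨⟨_, hm⟩⟩ : Chain (Y ⟶ c.pt)), ?_, ?_⟩
  · refine hcc.hom_ext fun m => ?_
    have h := isLUB_comp' (c.ι.app m ≫ f) hm hl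
    rw [Category.assoc] at h
    refine eq_of_isLUB_of_eventually ?_ h m fun n hmn => ?_
    · exact fun a b hab => comp_le_comp le_rfl (hm hab)
    · have := comp_proj (hf n)
      rw [Category.comp_id, ← c.w (homOfLE hmn), Category.assoc, Category.assoc]
      refine Eq.trans ?_ (congrArg (K.map (homOfLE hmn) ≫ ·)
        (Category.id_comp (c.ι.app n)))
      change _ = K.map (homOfLE hmn) ≫ 𝟙 _ ≫ c.ι.app n
      rw [← this]
      simp
  · refine (isLUB_comp hm hl f).2 ?_
    rintro _ ⟨n, rfl⟩
    change (proj (hf n) ≫ c.ι.app n) ≫ f ≤ 𝟙 _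
    rw [Category.assoc]
    exact hq n

end LimitColimit

end CPO
/-! ### `ω`-colimits in wide subcategories -/

section Wide

variable {C : Type u₁} [Category.{v₁} C] {D : Type u₂} [Category.{v₂} D]

/-- A wide subcategory whose `ω`-diagrams have colimits in the ambient category that are also
colimits in the subcategory. -/
class IsOmegaClosed (P : MorphismProperty C) [P.IsMultiplicative] : Prop where
  hasColimit : ∀ K : ℕ ⥤ WideSubcategory P, HasColimit (K ⋙ wideSubcategoryInclusion P)
  ι_mem : ∀ (K : ℕ ⥤ WideSubcategory P) (c : Cocone (K ⋙ wideSubcategoryInclusion P)),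
    IsColimit c → ∀ n, P (c.ι.app n)
  desc_mem : ∀ (K : ℕ ⥤ WideSubcategory P) (c : Cocone (K ⋙ wideSubcategoryInclusion P)),
    IsColimit c → ∀ {Y : C} (f : c.pt ⟶ Y), (∀ n, P (c.ι.app n ≫ f)) → P f

variable (P : MorphismProperty C) [P.IsMultiplicative] [IsOmegaClosed P]

theorem isColimit_wide {K : ℕ ⥤ WideSubcategory P} {c : Cocone K}
    (hc : IsColimit ((wideSubcategoryInclusion P).mapCocone c)) : Nonempty (IsColimit c) :=
  ⟨{
    desc := fun s => ⟨hc.desc ((wideSubcategoryInclusion P).mapCocone s),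
      IsOmegaClosed.desc_mem K _ hc _ (fun n => Eq.mpr
        (congrArg (fun k => P k) (hc.fac ((wideSubcategoryInclusion P).mapCocone s) n))
        (s.ι.app n).property)⟩
    fac := fun s n => WideSubcategory.hom_ext P
      (hc.fac ((wideSubcategoryInclusion P).mapCocone s) n)
    uniq := fun s m w => WideSubcategory.hom_ext P
      (hc.uniq ((wideSubcategoryInclusion P).mapCocone s) m.hom
        (fun n => congrArg InducedWideCategory.Hom.hom (w n))) }⟩

/-- The colimit cocone of an `ω`-diagram in a wide subcategory. -/
noncomputable def wideCocone (K : ℕ ⥤ WideSubcategory P) : Cocone K :=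
  haveI := IsOmegaClosed.hasColimit K
  { pt := ⟨colimit (K ⋙ wideSubcategoryInclusion P)⟩
    ι :=
      { app := fun n => ⟨colimit.ι (K ⋙ wideSubcategoryInclusion P) n,
          IsOmegaClosed.ι_mem K _ (colimit.isColimit _) n⟩
        naturality := fun _ _ f => WideSubcategory.hom_ext P
          ((colimit.cocone (K ⋙ wideSubcategoryInclusion P)).ι.naturality f) } }

instance hasColimitsOfShape_wide : HasColimitsOfShape ℕ (WideSubcategory P) where
  has_colimit K := by
    have := IsOmegaClosed.hasColimit K
    obtain ⟨h⟩ := isColimit_wide P (c := wideCocone P K)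
      (colimit.isColimit (K ⋙ wideSubcategoryInclusion P))
    exact ⟨⟨_, h⟩⟩

instance isOmegaFunctor_inclusion : IsOmegaFunctor (wideSubcategoryInclusion P) where
  preservesColimit {K} := by
    have := IsOmegaClosed.hasColimit K
    obtain ⟨h⟩ := isColimit_wide P (c := wideCocone P K)
      (colimit.isColimit (K ⋙ wideSubcategoryInclusion P))
    exact preservesColimit_of_preserves_colimit_cocone h
      (colimit.isColimit (K ⋙ wideSubcategoryInclusion P))

/-- An `ω`-functor into the wide subcategory can be recognised in the ambient category. -/
theorem isOmegaFunctor_of_comp_inclusion (T : D ⥤ WideSubcategory P)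
    (h : ∀ (K : ℕ ⥤ D) (c : Cocone K), IsColimit c →
      Nonempty (IsColimit ((wideSubcategoryInclusion P).mapCocone (T.mapCocone c)))) :
    IsOmegaFunctor T where
  preservesColimit {K} := ⟨fun {c} hc => by
    obtain ⟨h'⟩ := h K c hc
    exact isColimit_wide P h'⟩

theorem hasInitial_wide {C : Type u₁} [Category.{v₁} C] (P : MorphismProperty C)
    [P.IsMultiplicative] [HasInitial C] (h : ∀ X : C, P (initial.to X)) :
    HasInitial (WideSubcategory P) :=
  IsInitial.hasInitial (X := (⟨⊥_ C⟩ : WideSubcategory P)) (IsInitial.ofUniqueHom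
    (fun X => ⟨initial.to X.obj, h X.obj⟩)
    (fun _ _ => WideSubcategory.hom_ext P (initialIsInitial.hom_ext _ _)))

end Wide

/-! ### Functors on categories of embeddings -/

section EmbFunctors

/-- `C` has all `ω`-colimits over embeddings. -/
class HasOmegaColimitsOfEmbeddings (C : Type u₁) [Category.{v₁} C] [CPOCategory C] : Prop where
  hasColimit : ∀ K : ℕ ⥤ C, (∀ {m n : ℕ} (f : m ⟶ n), embeddings C (K.map f)) → HasColimit K

variable {A : Type u₁} [Category.{v₁} A] [CPOCategory A]
variable {B : Type u₂} [Category.{v₂} B] [CPOCategory B]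
variable {C : Type u₃} [Category.{v₃} C] [CPOCategory C]

theorem emb_diagram (K : ℕ ⥤ Emb C) {m n : ℕ} (f : m ⟶ n) :
    embeddings C ((K ⋙ wideSubcategoryInclusion _).map f) := (K.map f).property

instance [HasOmegaColimitsOfEmbeddings C] : IsOmegaClosed (embeddings C) where
  hasColimit K := HasOmegaColimitsOfEmbeddings.hasColimit _ (emb_diagram K)
  ι_mem K c hc n := by
    obtain ⟨p, h₁, h₂, -⟩ := hasEPSup_of_isColimit (emb_diagram K) hc
    exact ⟨p n, h₁ n, h₂ n⟩
  desc_mem K c hc Y f hf := embeddings_desc (hasEPSup_of_isColimit (emb_diagram K) hc) f hf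

/-- A colimit of an `ω`-diagram of embeddings is given by a supremum of idempotents. -/
theorem hasEPSup_emb [HasOmegaColimitsOfEmbeddings C] {K : ℕ ⥤ Emb C} {c : Cocone K}
    (hc : IsColimit c) : HasEPSup ((wideSubcategoryInclusion _).mapCocone c) :=
  hasEPSup_of_isColimit (emb_diagram K) (isColimitOfPreserves _ hc)

theorem embeddings_map (T : A ⥤ C) [IsCPOFunctor T] {X Y : A} {e : X ⟶ Y}
    (he : embeddings A e) : embeddings C (T.map e) := by
  obtain ⟨p, h₁, h₂⟩ := he
  refine ⟨T.map p, by rw [← T.map_comp, h₁, T.map_id], ?_⟩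
  rw [← T.map_comp, ← T.map_id]
  exact (IsCPOFunctor.map_continuous Y Y).monotone h₂

theorem HasEPSup.map (T : A ⥤ C) [IsCPOFunctor T] {K : ℕ ⥤ A} {c : Cocone K} (h : HasEPSup c) :
    HasEPSup (T.mapCocone c) := by
  obtain ⟨p, h₁, h₂, h₃⟩ := h
  refine ⟨fun n => T.map (p n), fun n => ?_, fun n => ?_, ?_⟩
  · exact (T.map_comp _ _).symm.trans ((congrArg T.map (h₁ n)).trans (T.map_id _))
  · refine le_trans (T.map_comp _ _).symm.le (le_trans ?_ (T.map_id _).le)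
    exact (IsCPOFunctor.map_continuous (T := T) _ _).monotone (h₂ n)
  · let d : Chain (c.pt ⟶ c.pt) := ⟨⟨_, monotone_proj_comp h₁ h₂ c⟩⟩
    have h := (IsCPOFunctor.map_continuous (T := T) c.pt c.pt).isLUB (c := d)
    have hd : 𝟙 c.pt = ωSup d := ωSup_eq_of_isLUB (c := d) h₃
    rw [← hd, T.map_id] at h
    have e : (fun n => T.map (p n) ≫ T.map (c.ι.app n)) = fun n => T.map (p n ≫ c.ι.app n) :=
      funext fun n => (T.map_comp _ _).symm
    change IsLUB (Set.range fun n => T.map (p n) ≫ T.map (c.ι.app n)) (𝟙 (T.obj c.pt))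
    rw [e]
    exact h

/-- The restriction `T_e : A_e ⥤ C_e` of a `CPO`-functor `T : A ⥤ C`. -/
@[simps]
def embMap (T : A ⥤ C) [IsCPOFunctor T] : Emb A ⥤ Emb C where
  obj X := ⟨T.obj X.obj⟩
  map f := ⟨T.map f.hom, embeddings_map T f.property⟩
  map_id X := WideSubcategory.hom_ext _ (T.map_id X.obj)
  map_comp f g := WideSubcategory.hom_ext _ (T.map_comp f.hom g.hom)

instance [HasOmegaColimitsOfEmbeddings A] [HasOmegaColimitsOfEmbeddings C]
    (T : A ⥤ C) [IsCPOFunctor T] : IsOmegaFunctor (embMap T) :=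
  isOmegaFunctor_of_comp_inclusion _ _ (fun _ _ hc =>
    ((hasEPSup_emb hc).map T).isColimit)

/-- The induced idempotents of a cocone are determined by the cocone. -/
theorem HasEPSup.isLUB {K : ℕ ⥤ C} {c : Cocone K} (h : HasEPSup c)
    (hc : ∀ n, embeddings C (c.ι.app n)) :
    Monotone (fun n => proj (hc n) ≫ c.ι.app n) ∧
      IsLUB (Set.range fun n => proj (hc n) ≫ c.ι.app n) (𝟙 c.pt) := by
  obtain ⟨p, h₁, h₂, h₃⟩ := h
  have hp (n : ℕ) : p n = proj (hc n) := eq_proj (hc n) (h₁ n) (h₂ n)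
  obtain rfl : p = fun n => proj (hc n) := funext hp
  exact ⟨monotone_proj_comp h₁ h₂ c, h₃⟩

theorem hasEPSup_of_bimap {X : A} {Y : B} {a : ℕ → (X ⟶ X)} {b : ℕ → (Y ⟶ Y)} (ha : Monotone a)
    (hb : Monotone b) (ha' : IsLUB (Set.range a) (𝟙 X)) (hb' : IsLUB (Set.range b) (𝟙 Y))
    {K : ℕ ⥤ C} {c : Cocone K} {Ψ : (X ⟶ X) × (Y ⟶ Y) → (c.pt ⟶ c.pt)}
    (hΨ : ωScottContinuous Ψ) (hid : Ψ (𝟙 X, 𝟙 Y) = 𝟙 c.pt) (p : ∀ n, c.pt ⟶ K.obj n)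
    (hp : ∀ n, c.ι.app n ≫ p n = 𝟙 _) (hp' : ∀ n, p n ≫ c.ι.app n = Ψ (a n, b n)) :
    HasEPSup c := by
  let d : Chain ((X ⟶ X) × (Y ⟶ Y)) := Chain.zip ⟨⟨a, ha⟩⟩ ⟨⟨b, hb⟩⟩
  have hd : ωSup d = (𝟙 X, 𝟙 Y) := Prod.ext
    (ωSup_eq_of_isLUB (c := ⟨⟨a, ha⟩⟩) ha').symm (ωSup_eq_of_isLUB (c := ⟨⟨b, hb⟩⟩) hb').symm
  have h := hΨ.isLUB (c := d)
  rw [hd, hid] at h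
  have e : (fun n => p n ≫ c.ι.app n) = fun n => Ψ (a n, b n) := funext hp'
  have h' : IsLUB (Set.range fun n => p n ≫ c.ι.app n) (𝟙 c.pt) := by rw [e]; exact h
  exact ⟨p, hp, fun n => h'.1 ⟨n, rfl⟩, h'⟩

/-- The restriction `T_e : A_e × B_e ⥤ C_e` of a `CPO`-functor `T : A × B ⥤ C`. -/
def embBimap (T : A × B ⥤ C) [IsCPOBifunctor T] : Emb A × Emb B ⥤ Emb C where
  obj X := ⟨T.obj (X.1.obj, X.2.obj)⟩
  map {X Y} f := ⟨T.map (Prod.mkHom f.1.hom f.2.hom), by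
    obtain ⟨p, h₁, h₂⟩ := f.1.property
    obtain ⟨q, h₃, h₄⟩ := f.2.property
    refine ⟨T.map (Prod.mkHom p q), ?_, ?_⟩
    · rw [← T.map_comp, ← T.map_id]
      exact congrArg T.map (Prod.ext h₁ h₃)
    · rw [← T.map_comp, ← T.map_id]
      exact (IsCPOBifunctor.map_continuous (T := T) Y.1.obj Y.1.obj Y.2.obj Y.2.obj).monotone
        (a := (p ≫ f.1.hom, q ≫ f.2.hom)) (b := (𝟙 _, 𝟙 _)) ⟨h₂, h₄⟩⟩
  map_id X := WideSubcategory.hom_ext _ (T.map_id (X.1.obj, X.2.obj))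
  map_comp f g := WideSubcategory.hom_ext _
    (T.map_comp (Prod.mkHom f.1.hom f.2.hom) (Prod.mkHom g.1.hom g.2.hom))

instance [HasOmegaColimitsOfEmbeddings A] [HasOmegaColimitsOfEmbeddings B]
    [HasOmegaColimitsOfEmbeddings C] (T : A × B ⥤ C) [IsCPOBifunctor T] :
    IsOmegaFunctor (embBimap T) := by
  refine isOmegaFunctor_of_comp_inclusion _ _ (fun K c hc => HasEPSup.isColimit ?_)
  obtain ⟨ha, ha'⟩ := (hasEPSup_emb (isColimitOfPreserves (CategoryTheory.Prod.fst _ _) hc)).isLUB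
    (fun n => (c.ι.app n).1.property)
  obtain ⟨hb, hb'⟩ := (hasEPSup_emb (isColimitOfPreserves (CategoryTheory.Prod.snd _ _) hc)).isLUB
    (fun n => (c.ι.app n).2.property)
  refine hasEPSup_of_bimap ha hb ha' hb'
    (IsCPOBifunctor.map_continuous (T := T) c.pt.1.obj c.pt.1.obj c.pt.2.obj c.pt.2.obj)
    (T.map_id (c.pt.1.obj, c.pt.2.obj))
    (fun n => T.map (Prod.mkHom (proj (c.ι.app n).1.property) (proj (c.ι.app n).2.property)))
    (fun n => ?_) (fun n => (T.map_comp _ _).symm)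
  refine (T.map_comp _ _).symm.trans (Eq.trans ?_ (T.map_id _))
  exact congrArg T.map (Prod.ext (comp_proj (c.ι.app n).1.property)
    (comp_proj (c.ι.app n).2.property))

/-- The covariant functor `T_e : A_e × B_e ⥤ C_e` determined by a `CPO`-functor
`T : Aᵒᵖ × B ⥤ C`; it sends `(e₁, e₂)` to `T (e₁^•, e₂)`, where `e₁^•` is the projection
counterpart of `e₁`. -/
noncomputable def embMixedBimap (T : Aᵒᵖ × B ⥤ C) [IsCPOMixedBifunctor T] :
    Emb A × Emb B ⥤ Emb C where
  obj X := ⟨T.obj (Opposite.op X.1.obj, X.2.obj)⟩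
  map {X Y} f := ⟨T.map (Prod.mkHom (proj f.1.property).op f.2.hom), by
    refine ⟨T.map (Prod.mkHom f.1.hom.op (proj f.2.property)), ?_, ?_⟩
    · rw [← T.map_comp, ← T.map_id]
      exact congrArg T.map (Prod.ext (congrArg Quiver.Hom.op (comp_proj f.1.property))
        (comp_proj f.2.property))
    · rw [← T.map_comp, ← T.map_id]
      exact (IsCPOMixedBifunctor.map_continuous (T := T)
        Y.1.obj Y.1.obj Y.2.obj Y.2.obj).monotone
        (a := (proj f.1.property ≫ f.1.hom, proj f.2.property ≫ f.2.hom)) (b := (𝟙 _, 𝟙 _))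
        ⟨proj_comp f.1.property, proj_comp f.2.property⟩⟩
  map_id X := WideSubcategory.hom_ext _ (by
    refine Eq.trans ?_ (T.map_id (Opposite.op X.1.obj, X.2.obj))
    exact congrArg T.map (Prod.ext (congrArg Quiver.Hom.op (proj_id X.1.obj _)) rfl))
  map_comp f g := WideSubcategory.hom_ext _ (by
    refine Eq.trans ?_ (T.map_comp (Prod.mkHom (proj f.1.property).op f.2.hom)
      (Prod.mkHom (proj g.1.property).op g.2.hom))
    exact congrArg T.map (Prod.ext (congrArg Quiver.Hom.op
      (proj_comp_eq f.1.property g.1.property _)) rfl))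

instance [HasOmegaColimitsOfEmbeddings A] [HasOmegaColimitsOfEmbeddings B]
    [HasOmegaColimitsOfEmbeddings C] (T : Aᵒᵖ × B ⥤ C) [IsCPOMixedBifunctor T] :
    IsOmegaFunctor (embMixedBimap T) := by
  refine isOmegaFunctor_of_comp_inclusion _ _ (fun K c hc => HasEPSup.isColimit ?_)
  obtain ⟨ha, ha'⟩ := (hasEPSup_emb (isColimitOfPreserves (CategoryTheory.Prod.fst _ _) hc)).isLUB
    (fun n => (c.ι.app n).1.property)
  obtain ⟨hb, hb'⟩ := (hasEPSup_emb (isColimitOfPreserves (CategoryTheory.Prod.snd _ _) hc)).isLUB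
    (fun n => (c.ι.app n).2.property)
  refine hasEPSup_of_bimap ha hb ha' hb'
    (IsCPOMixedBifunctor.map_continuous (T := T) c.pt.1.obj c.pt.1.obj c.pt.2.obj c.pt.2.obj)
    (T.map_id (Opposite.op c.pt.1.obj, c.pt.2.obj))
    (fun n => T.map (Prod.mkHom (c.ι.app n).1.hom.op (proj (c.ι.app n).2.property)))
    (fun n => ?_) (fun n => (T.map_comp _ _).symm)
  refine (T.map_comp _ _).symm.trans (Eq.trans ?_ (T.map_id _))
  exact congrArg T.map (Prod.ext (congrArg Quiver.Hom.op (comp_proj (c.ι.app n).1.property))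
    (comp_proj (c.ι.app n).2.property))

end EmbFunctors

/-! ### `CPO`-`LNL` models -/

section Model

set_option linter.unusedSectionVars false

/-- The coproduct functor. -/
@[simps]
noncomputable def sumFunctor (C : Type u₁) [Category.{v₁} C] [HasBinaryCoproducts C] :
    C × C ⥤ C where
  obj X := X.1 ⨿ X.2
  map f := coprod.map f.1 f.2

/-- The coproduct functor is left adjoint to the diagonal functor. -/
noncomputable def sumAdj (C : Type u₁) [Category.{v₁} C] [HasBinaryCoproducts C] :
    sumFunctor C ⊣ (𝟭 C).prod' (𝟭 C) :=
  Adjunction.mkOfHomEquiv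
    { homEquiv := fun _ _ =>
        { toFun := fun f => Prod.mkHom (coprod.inl ≫ f) (coprod.inr ≫ f)
          invFun := fun g => coprod.desc g.1 g.2
          left_inv := fun _ => coprod.hom_ext (coprod.inl_desc _ _) (coprod.inr_desc _ _)
          right_inv := fun _ => Prod.ext (coprod.inl_desc _ _) (coprod.inr_desc _ _) }
      homEquiv_naturality_left_symm := fun f _ => coprod.hom_ext
        ((coprod.inl_desc _ _).trans ((coprod.inl_map_assoc _ _ _).trans
          (congrArg (f.1 ≫ ·) (coprod.inl_desc _ _))).symm)
        ((coprod.inr_desc _ _).trans ((coprod.inr_map_assoc _ _ _).trans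
          (congrArg (f.2 ≫ ·) (coprod.inr_desc _ _))).symm)
      homEquiv_naturality_right := fun _ _ =>
        Prod.ext (Category.assoc _ _ _).symm (Category.assoc _ _ _).symm }

/-- The symmetric monoidal closed structure of `L` is `CPO`-enriched. -/
class CPOMonoidalClosed (L : Type u₂) [Category.{v₂} L] [CPOCategory L] [MonoidalCategory L]
    [MonoidalClosed L] : Prop where
  tensor_cpo : IsCPOBifunctor (tensor L)
  ihom_cpo : IsCPOMixedBifunctor (Functor.uncurry.obj (MonoidalClosed.internalHom (C := L)))

/-- The cartesian structure of `C` is `CPO`-enriched. -/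
class CPOCartesian (C : Type u₁) [Category.{v₁} C] [CPOCategory C]
    [CartesianMonoidalCategory C] : Prop where
  tensor_cpo : IsCPOBifunctor (tensor C)

/-- The coproducts of `C` are `CPO`-enriched. -/
class CPOCoproducts (C : Type u₁) [Category.{v₁} C] [CPOCategory C]
    [HasBinaryCoproducts C] : Prop where
  sum_cpo : IsCPOBifunctor (sumFunctor C)

/-- The initial object of `C` is e-initial: every morphism out of it is an embedding. -/
class HasEInitial (C : Type u₁) [Category.{v₁} C] [CPOCategory C] [HasInitial C] : Prop where
  embedding_to : ∀ X : C, embeddings C (initial.to X)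

attribute [instance] CPOMonoidalClosed.tensor_cpo CPOMonoidalClosed.ihom_cpo
  CPOCoproducts.sum_cpo

/-- The pre-embeddings with respect to `T`: the morphisms that `T` maps to embeddings. -/
abbrev preEmbeddings {C : Type u₁} [Category.{v₁} C] {L : Type u₂} [Category.{v₂} L]
    [CPOCategory L] (T : C ⥤ L) : MorphismProperty C := (embeddings L).inverseImage T

/-- A `CPO`-`LNL` model: a `CPO`-symmetric monoidal adjunction `F ⊣ G : L ⥤ C` between a
`CPO`-cartesian category `C` and a `CPO`-symmetric monoidal closed category `L`, both with finite
`CPO`-coproducts, such that `L` has an e-initial object and all `ω`-colimits over embeddings, and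
`C` has all `ω`-colimits over pre-embeddings with respect to `F`, which the product functor
preserves. -/
structure LNLModel
    (C : Type u₁) [Category.{v₁} C] [CPOCategory C]
      [CartesianMonoidalCategory C] [BraidedCategory C] [HasFiniteCoproducts C]
      [CPOCartesian C] [CPOCoproducts C]
    (L : Type u₂) [Category.{v₂} L] [CPOCategory L]
      [MonoidalCategory L] [SymmetricCategory L] [MonoidalClosed L] [HasFiniteCoproducts L]
      [CPOMonoidalClosed L] [CPOCoproducts L] [HasEInitial L] [HasOmegaColimitsOfEmbeddings L] where
  F : C ⥤ L
  G : L ⥤ C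
  [braided : F.Braided]
  [laxBraided : G.LaxBraided]
  adj : F ⊣ G
  [adj_isMonoidal : adj.IsMonoidal]
  [left_cpo : IsCPOFunctor F]
  [right_cpo : IsCPOFunctor G]
  hasColimit : ∀ K : ℕ ⥤ C, (∀ {m n : ℕ} (f : m ⟶ n), preEmbeddings F (K.map f)) → HasColimit K
  preserves_tensor : ∀ K : ℕ ⥤ C × C, (∀ {m n : ℕ} (f : m ⟶ n),
    preEmbeddings F (K.map f).1 ∧ preEmbeddings F (K.map f).2) → PreservesColimit K (tensor C)

attribute [instance] LNLModel.braided LNLModel.laxBraided LNLModel.adj_isMonoidal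
  LNLModel.left_cpo LNLModel.right_cpo

variable {C : Type u₁} [Category.{v₁} C] [CPOCategory C]
  [CartesianMonoidalCategory C] [BraidedCategory C] [HasFiniteCoproducts C]
  [CPOCartesian C] [CPOCoproducts C]
variable {L : Type u₂} [Category.{v₂} L] [CPOCategory L]
  [MonoidalCategory L] [SymmetricCategory L] [MonoidalClosed L] [HasFiniteCoproducts L]
  [CPOMonoidalClosed L] [CPOCoproducts L] [HasEInitial L] [HasOmegaColimitsOfEmbeddings L]
variable (M : LNLModel C L)

namespace LNLModel

/-- The wide subcategory `C_pe` of pre-embeddings with respect to `F`. -/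
abbrev Cpe : Type u₁ := WideSubcategory (preEmbeddings M.F)

instance preservesColimits_F : PreservesColimitsOfSize.{0, 0} M.F :=
  M.adj.leftAdjoint_preservesColimits

theorem emb_diagram_pe (K : ℕ ⥤ M.Cpe) {m n : ℕ} (f : m ⟶ n) :
    embeddings L (((K ⋙ wideSubcategoryInclusion _) ⋙ M.F).map f) := (K.map f).property

instance : IsOmegaClosed (preEmbeddings M.F) where
  hasColimit K := M.hasColimit _ (M.emb_diagram_pe K)
  ι_mem K c hc n := by
    obtain ⟨p, h₁, h₂, -⟩ :=
      hasEPSup_of_isColimit (M.emb_diagram_pe K) (isColimitOfPreserves M.F hc)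
    exact ⟨p n, h₁ n, h₂ n⟩
  desc_mem K c hc Y f hf :=
    embeddings_desc (hasEPSup_of_isColimit (M.emb_diagram_pe K) (isColimitOfPreserves M.F hc))
      (M.F.map f) (fun n => by
        have := hf n
        change embeddings L (M.F.map _) at this
        rwa [M.F.map_comp] at this)

instance hasInitial_emb : HasInitial (Emb L) :=
  hasInitial_wide _ HasEInitial.embedding_to

theorem preEmbeddings_initial (X : C) : preEmbeddings M.F (initial.to X) := by
  let e : M.F.obj (⊥_ C) ≅ ⊥_ L :=
    (IsInitial.isInitialObj M.F _ initialIsInitial).uniqueUpToIso initialIsInitial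
  have h : M.F.map (initial.to X) = e.hom ≫ initial.to _ :=
    (IsInitial.isInitialObj M.F _ initialIsInitial).hom_ext _ _
  change embeddings L (M.F.map (initial.to X))
  rw [h]
  exact (embeddings L).comp_mem _ _ (embeddings_of_iso e) (HasEInitial.embedding_to _)

instance hasInitial_pe : HasInitial M.Cpe := hasInitial_wide _ M.preEmbeddings_initial

/-- The restriction `F_pe : C_pe ⥤ L_e` of `F`. -/
@[simps]
def Fpe : M.Cpe ⥤ Emb L where
  obj X := ⟨M.F.obj X.obj⟩
  map f := ⟨M.F.map f.hom, f.property⟩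
  map_id X := WideSubcategory.hom_ext _ (M.F.map_id X.obj)
  map_comp f g := WideSubcategory.hom_ext _ (M.F.map_comp f.hom g.hom)

instance isOmegaFunctor_Fpe : IsOmegaFunctor M.Fpe :=
  isOmegaFunctor_of_comp_inclusion _ _ (fun _ _ hc =>
    ⟨isColimitOfPreserves M.F (isColimitOfPreserves (wideSubcategoryInclusion _) hc)⟩)

instance preservesInitial_Fpe : PreservesColimit (Functor.empty.{0} M.Cpe) M.Fpe := by
  let i : IsInitial (⟨⊥_ C⟩ : M.Cpe) := IsInitial.ofUniqueHom
    (fun X => ⟨initial.to X.obj, M.preEmbeddings_initial X.obj⟩)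
    (fun _ _ => WideSubcategory.hom_ext _ (initialIsInitial.hom_ext _ _))
  let hF : IsInitial (M.F.obj (⊥_ C)) := IsInitial.isInitialObj M.F _ initialIsInitial
  let j : IsInitial (M.Fpe.obj ⟨⊥_ C⟩) := IsInitial.ofUniqueHom
    (fun X => ⟨hF.to X.obj, by
      let e : M.F.obj (⊥_ C) ≅ ⊥_ L := hF.uniqueUpToIso initialIsInitial
      have h : hF.to X.obj = e.hom ≫ initial.to _ := hF.hom_ext _ _
      rw [h]
      exact (embeddings L).comp_mem _ _ (embeddings_of_iso e) (HasEInitial.embedding_to _)⟩)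
    (fun _ _ => WideSubcategory.hom_ext _ (hF.hom_ext _ _))
  exact preservesInitial_of_iso M.Fpe
    (initialIsInitial.uniqueUpToIso j ≪≫ M.Fpe.mapIso (i.uniqueUpToIso initialIsInitial))

/-- The restriction `G_pe : L_e ⥤ C_pe` of `G`, i.e. `G_e : L_e ⥤ C_e` followed by the inclusion
`C_e ⥤ C_pe`. -/
@[simps]
def Gpe : Emb L ⥤ M.Cpe where
  obj X := ⟨M.G.obj X.obj⟩
  map f := ⟨M.G.map f.hom, embeddings_map M.F (embeddings_map M.G f.property)⟩
  map_id X := WideSubcategory.hom_ext _ (M.G.map_id X.obj)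
  map_comp f g := WideSubcategory.hom_ext _ (M.G.map_comp f.hom g.hom)

instance isOmegaFunctor_Gpe : IsOmegaFunctor M.Gpe :=
  isOmegaFunctor_of_comp_inclusion _ _ (fun _ _ hc => ((hasEPSup_emb hc).map M.G).isColimit)

instance isCPOFunctor_bang : IsCPOFunctor (M.G ⋙ M.F) where
  map_continuous X Y := (IsCPOFunctor.map_continuous (T := M.F) (M.G.obj X) (M.G.obj Y)).comp
    (IsCPOFunctor.map_continuous (T := M.G) X Y)

/-- `!_e : L_e ⥤ L_e`, where `! = F ∘ G`. -/
def bangE : Emb L ⥤ Emb L := embMap (M.G ⋙ M.F)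

instance isOmegaFunctor_bangE : IsOmegaFunctor M.bangE :=
  inferInstanceAs (IsOmegaFunctor (embMap (M.G ⋙ M.F)))

variable (L) in
/-- `⊗_e`. -/
def tensorE : Emb L × Emb L ⥤ Emb L := embBimap (tensor L)

variable (L) in
/-- `+_e`. -/
noncomputable def sumE : Emb L × Emb L ⥤ Emb L := embBimap (sumFunctor L)

variable (L) in
/-- `⊸_e`. -/
noncomputable def lolliE : Emb L × Emb L ⥤ Emb L :=
  embMixedBimap (Functor.uncurry.obj (MonoidalClosed.internalHom (C := L)))

instance isOmegaFunctor_tensorE : IsOmegaFunctor (tensorE L) :=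
  inferInstanceAs (IsOmegaFunctor (embBimap (tensor L)))

instance isOmegaFunctor_sumE : IsOmegaFunctor (sumE L) :=
  inferInstanceAs (IsOmegaFunctor (embBimap (sumFunctor L)))

instance isOmegaFunctor_lolliE : IsOmegaFunctor (lolliE L) :=
  inferInstanceAs (IsOmegaFunctor (embMixedBimap (Functor.uncurry.obj MonoidalClosed.internalHom)))

section Restrict

variable {M}
variable {S : L × L ⥤ L} [IsCPOBifunctor S] {T : C × C ⥤ C}

/-- The restriction `T_pe : C_pe × C_pe ⥤ C_pe` of a bifunctor `T` for which there is a natural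
isomorphism `β : S ∘ (F × F) ≅ F ∘ T`, where `S` is a `CPO`-functor. -/
def restrictPe (β : M.F.prod M.F ⋙ S ≅ T ⋙ M.F) : M.Cpe × M.Cpe ⥤ M.Cpe where
  obj X := ⟨T.obj (X.1.obj, X.2.obj)⟩
  map {X Y} f := ⟨T.map (Prod.mkHom f.1.hom f.2.hom), by
    have h : M.F.map (T.map (Prod.mkHom f.1.hom f.2.hom)) =
        (β.app (X.1.obj, X.2.obj)).symm.hom ≫ ((embBimap S).map
          (Prod.mkHom (M.Fpe.map f.1) (M.Fpe.map f.2))).hom ≫ (β.app (Y.1.obj, Y.2.obj)).hom := by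
      refine ((Iso.inv_comp_eq _).2 ?_).symm
      exact β.hom.naturality (X := (X.1.obj, X.2.obj)) (Y := (Y.1.obj, Y.2.obj))
        (Prod.mkHom f.1.hom f.2.hom)
    change embeddings L (M.F.map _)
    rw [h]
    exact (embeddings L).comp_mem _ _ (embeddings_of_iso _)
      ((embeddings L).comp_mem _ _ (InducedWideCategory.Hom.property _) (embeddings_of_iso _))⟩
  map_id X := WideSubcategory.hom_ext _ (T.map_id (X.1.obj, X.2.obj))
  map_comp f g := WideSubcategory.hom_ext _
    (T.map_comp (Prod.mkHom f.1.hom f.2.hom) (Prod.mkHom g.1.hom g.2.hom))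

/-- The restriction `β^pe : S_e ∘ (F_pe × F_pe) ≅ F_pe ∘ T_pe` of `β`. -/
def restrictPeIso (β : M.F.prod M.F ⋙ S ≅ T ⋙ M.F) :
    M.Fpe.prod M.Fpe ⋙ embBimap S ≅ restrictPe β ⋙ M.Fpe :=
  NatIso.ofComponents
    (fun X => WideSubcategory.isoMk (β.app (X.1.obj, X.2.obj)) (embeddings_of_iso _)
      (embeddings_of_iso (β.app (X.1.obj, X.2.obj)).symm))
    (fun {X Y} f => WideSubcategory.hom_ext _
      (β.hom.naturality (X := (X.1.obj, X.2.obj)) (Y := (Y.1.obj, Y.2.obj))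
        (Prod.mkHom f.1.hom f.2.hom)))

theorem isOmegaFunctor_restrictPe (β : M.F.prod M.F ⋙ S ≅ T ⋙ M.F)
    (hT : ∀ K : ℕ ⥤ C × C, (∀ {m n : ℕ} (f : m ⟶ n),
      preEmbeddings M.F (K.map f).1 ∧ preEmbeddings M.F (K.map f).2) → PreservesColimit K T) :
    IsOmegaFunctor (restrictPe β) := by
  refine isOmegaFunctor_of_comp_inclusion _ _ (fun K c hc => ?_)
  let I : M.Cpe × M.Cpe ⥤ C × C :=
    (wideSubcategoryInclusion _).prod (wideSubcategoryInclusion _)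
  have : PreservesColimit (K ⋙ I) T :=
    hT (K ⋙ I) (fun f => ⟨(K.map f).1.property, (K.map f).2.property⟩)
  have h₁ := isColimitOfPreserves (wideSubcategoryInclusion _)
    (isColimitOfPreserves (CategoryTheory.Prod.fst _ _) hc)
  have h₂ := isColimitOfPreserves (wideSubcategoryInclusion _)
    (isColimitOfPreserves (CategoryTheory.Prod.snd _ _) hc)
  obtain ⟨h⟩ : Nonempty (IsColimit (I.mapCocone c)) := isColimit_prod ⟨h₁⟩ ⟨h₂⟩
  exact ⟨isColimitOfPreserves T h⟩

end Restrict

/-- The natural isomorphism `m : F X ⊗ F Y ≅ F (X × Y)`. -/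
def tensorIso : M.F.prod M.F ⋙ tensor L ≅ tensor C ⋙ M.F :=
  NatIso.ofComponents (fun X => Functor.Monoidal.μIso M.F X.1 X.2)
    (fun f => Functor.LaxMonoidal.μ_natural M.F f.1 f.2)

/-- The natural isomorphism `c : F X + F Y ≅ F (X ⨿ Y)`. -/
noncomputable def sumIso : M.F.prod M.F ⋙ sumFunctor L ≅ sumFunctor C ⋙ M.F :=
  NatIso.ofComponents (fun X => PreservesColimitPair.iso M.F X.1 X.2)
    (fun f => coprod.hom_ext
      (by simp [sumFunctor, ← Functor.map_comp]) (by simp [sumFunctor, ← Functor.map_comp]))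

/-- `×_pe`. -/
def tensorPe : M.Cpe × M.Cpe ⥤ M.Cpe := restrictPe M.tensorIso

/-- `⨿_pe`. -/
noncomputable def sumPe : M.Cpe × M.Cpe ⥤ M.Cpe := restrictPe M.sumIso

instance isOmegaFunctor_tensorPe : IsOmegaFunctor M.tensorPe :=
  isOmegaFunctor_restrictPe _ M.preserves_tensor

instance isOmegaFunctor_sumPe : IsOmegaFunctor M.sumPe :=
  isOmegaFunctor_restrictPe _ (fun _ _ =>
    haveI := (sumAdj C).leftAdjoint_preservesColimits.{0, 0}
    inferInstance)

/-- `m^pe`. -/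
def tensorPeIso : M.Fpe.prod M.Fpe ⋙ tensorE L ≅ M.tensorPe ⋙ M.Fpe := restrictPeIso M.tensorIso

/-- `c^pe`. -/
noncomputable def sumPeIso : M.Fpe.prod M.Fpe ⋙ sumE L ≅ M.sumPe ⋙ M.Fpe :=
  restrictPeIso M.sumIso

end LNLModel

end Model

/-! ### Types -/

/-- The types `Θ ⊢ A` in a context `Θ` of `n` type variables, represented by de Bruijn indices:
the variable `0` is the last one of the context, and `mu A` binds the variable `0` of `A`. -/
inductive Ty : ℕ → Type
  | var {n : ℕ} (i : Fin n) : Ty n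
  | bang {n : ℕ} (A : Ty n) : Ty n
  | sum {n : ℕ} (A B : Ty n) : Ty n
  | tensor {n : ℕ} (A B : Ty n) : Ty n
  | lolli {n : ℕ} (A B : Ty n) : Ty n
  | mu {n : ℕ} (A : Ty (n + 1)) : Ty n

namespace Ty

/-- The non-linear types, `P, Q ::= X | !A | P + Q | P ⊗ Q | μX.P`. -/
def NonLinear : ∀ {n : ℕ}, Ty n → Prop
  | _, var _ => True
  | _, bang _ => True
  | _, sum A B => A.NonLinear ∧ B.NonLinear
  | _, tensor A B => A.NonLinear ∧ B.NonLinear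
  | _, lolli _ _ => False
  | _, mu A => A.NonLinear

/-- Extend a renaming to a context with one more variable. -/
def liftRen {n m : ℕ} (ρ : Fin n → Fin m) : Fin (n + 1) → Fin (m + 1) :=
  Fin.cases 0 (fun i => (ρ i).succ)

/-- Renaming of type variables. -/
def rename : ∀ {n m : ℕ}, (Fin n → Fin m) → Ty n → Ty m
  | _, _, ρ, var i => var (ρ i)
  | _, _, ρ, bang A => bang (A.rename ρ)
  | _, _, ρ, sum A B => sum (A.rename ρ) (B.rename ρ)
  | _, _, ρ, tensor A B => tensor (A.rename ρ) (B.rename ρ)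
  | _, _, ρ, lolli A B => lolli (A.rename ρ) (B.rename ρ)
  | _, _, ρ, mu A => mu (A.rename (liftRen ρ))

/-- Extend a substitution to a context with one more variable. -/
def liftSub {n m : ℕ} (σ : Fin n → Ty m) : Fin (n + 1) → Ty (m + 1) :=
  Fin.cases (var 0) (fun i => (σ i).rename Fin.succ)

/-- Simultaneous capture-avoiding substitution. -/
def subst : ∀ {n m : ℕ}, (Fin n → Ty m) → Ty n → Ty m
  | _, _, σ, var i => σ i
  | _, _, σ, bang A => bang (A.subst σ)
  | _, _, σ, sum A B => sum (A.subst σ) (B.subst σ)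
  | _, _, σ, tensor A B => tensor (A.subst σ) (B.subst σ)
  | _, _, σ, lolli A B => lolli (A.subst σ) (B.subst σ)
  | _, _, σ, mu A => mu (A.subst (liftSub σ))

/-- The substitution `[B / X]`, where `X` is the last variable of the context. -/
def single {n : ℕ} (B : Ty n) : Fin (n + 1) → Ty n := Fin.cases B var

/-- `A[B / X]`, where `X` is the last variable of the context. -/
def inst {n : ℕ} (A : Ty (n + 1)) (B : Ty n) : Ty n := A.subst (single B)

theorem NonLinear.rename {n : ℕ} {A : Ty n} (h : A.NonLinear) :
    ∀ {m : ℕ} (ρ : Fin n → Fin m), (A.rename ρ).NonLinear := by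
  induction A with
  | var i => exact fun _ => trivial
  | bang A => exact fun _ => trivial
  | sum A B ihA ihB => exact fun ρ => ⟨ihA h.1 ρ, ihB h.2 ρ⟩
  | tensor A B ihA ihB => exact fun ρ => ⟨ihA h.1 ρ, ihB h.2 ρ⟩
  | lolli A B => exact h.elim
  | mu A ih => exact fun ρ => ih h (liftRen ρ)

theorem NonLinear.liftSub {n m : ℕ} {σ : Fin n → Ty m} (hσ : ∀ i, (σ i).NonLinear) :
    ∀ i, (liftSub σ i).NonLinear :=
  Fin.cases trivial (fun i => (hσ i).rename Fin.succ)

theorem NonLinear.subst {n : ℕ} {A : Ty n} (h : A.NonLinear) :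
    ∀ {m : ℕ} {σ : Fin n → Ty m}, (∀ i, (σ i).NonLinear) → (A.subst σ).NonLinear := by
  induction A with
  | var i => exact fun hσ => hσ i
  | bang A => exact fun _ => trivial
  | sum A B ihA ihB => exact fun hσ => ⟨ihA h.1 hσ, ihB h.2 hσ⟩
  | tensor A B ihA ihB => exact fun hσ => ⟨ihA h.1 hσ, ihB h.2 hσ⟩
  | lolli A B => exact h.elim
  | mu A ih => exact fun hσ => ih h (NonLinear.liftSub hσ)

theorem NonLinear.body {n : ℕ} {A : Ty (n + 1)} (h : A.mu.NonLinear) : A.NonLinear := h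

theorem NonLinear.single {n : ℕ} {B : Ty n} (h : B.NonLinear) : ∀ i, (single B i).NonLinear :=
  Fin.cases h (fun _ => trivial)

theorem NonLinear.inst {n : ℕ} {A : Ty (n + 1)} {B : Ty n} (hA : A.NonLinear)
    (hB : B.NonLinear) : (A.inst B).NonLinear :=
  hA.subst (NonLinear.single hB)

end Ty

/-! ### Tuples of functors -/

section Tuples

variable {A : Type u₁} [Category.{v₁} A] {E : Type u₂} [Category.{v₂} E]
variable {E' : Type u₃} [Category.{v₃} E']

/-- The isomorphism `⟨α, β⟩`. -/
def prodIso {F G : A ⥤ E} {H K : A ⥤ E'} (α : F ≅ G) (β : H ≅ K) : F.prod' H ≅ G.prod' K :=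
  NatIso.ofComponents (fun X => (α.app X).prod (β.app X))
    (fun f => Prod.ext (α.hom.naturality f) (β.hom.naturality f))

/-- The isomorphism `⟨α₁, …, αₙ⟩`. -/
def tupIso {n : ℕ} {F G : Fin n → A ⥤ E} (α : ∀ i, F i ≅ G i) :
    Functor.pi' F ≅ Functor.pi' G :=
  NatIso.ofComponents (fun X => Pi.isoMk (fun i => (α i).app X))
    (fun f => funext (fun i => (α i).hom.naturality f))

variable (E) in
/-- The identification of `E ^ n × E` with `E ^ (n + 1)`; the last component of the context
becomes the component `0`. -/
def extend (n : ℕ) : (Fin n → E) × E ⥤ (Fin (n + 1) → E) :=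
  Functor.pi' (Fin.cases (motive := fun _ => (Fin n → E) × E ⥤ E) (CategoryTheory.Prod.snd _ _)
    (fun i => CategoryTheory.Prod.fst _ _ ⋙ Pi.eval (fun _ => E) i))

variable (E) in
/-- The functor `E ^ m ⥤ E ^ n` determined by a map of indices. -/
def reindex {n m : ℕ} (ρ : Fin n → Fin m) : (Fin m → E) ⥤ (Fin n → E) :=
  Functor.pi' (fun i => Pi.eval (fun _ => E) (ρ i))

theorem extend_reindex_liftRen {n m : ℕ} (ρ : Fin n → Fin m) :
    extend E m ⋙ reindex E (Ty.liftRen ρ) = (reindex E ρ).prod (𝟭 E) ⋙ extend E n :=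
  Functor.pi_ext _ _ (Fin.cases rfl (fun _ => rfl))

theorem extend_reindex_succ (n : ℕ) :
    extend E n ⋙ reindex E Fin.succ = CategoryTheory.Prod.fst _ _ := rfl

theorem extend_pi' {n m : ℕ} (F : Fin n → (Fin m → E) ⥤ E)
    (F' : Fin (n + 1) → (Fin (m + 1) → E) ⥤ E) (h₀ : F' 0 = Pi.eval (fun _ => E) 0)
    (h : ∀ i : Fin n, F' i.succ = reindex E Fin.succ ⋙ F i) :
    extend E m ⋙ Functor.pi' F' = (Functor.pi' F).prod (𝟭 E) ⋙ extend E n := by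
  refine Functor.pi_ext _ _ (Fin.cases ?_ (fun i => ?_))
  · exact congrArg (extend E m ⋙ ·) h₀
  · exact congrArg (extend E m ⋙ ·) (h i)

/-- The identity isomorphism `M ^ (n + 1) ∘ extend ≅ extend ∘ (M ^ n × M)`. -/
def extendIso (n : ℕ) (M : E ⥤ E') :
    (Functor.pi (fun _ : Fin n => M)).prod M ⋙ extend E' n ≅
      extend E n ⋙ Functor.pi (fun _ : Fin (n + 1) => M) :=
  NatIso.pi' (Fin.cases (Iso.refl _) (fun _ => Iso.refl _))

instance hasColimitsOfShape_tuples (n : ℕ) [HasColimitsOfShape ℕ E] :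
    HasColimitsOfShape ℕ (Fin n → E) where
  has_colimit K := by
    let c : Cocone K :=
      { pt := fun i => colimit (K ⋙ Pi.eval (fun _ => E) i)
        ι :=
          { app := fun k i => colimit.ι (K ⋙ Pi.eval (fun _ => E) i) k
            naturality := fun _ _ f => funext fun i =>
              (colimit.cocone (K ⋙ Pi.eval (fun _ => E) i)).ι.naturality f } }
    obtain ⟨hc⟩ := isColimit_pi (c := c) fun i =>
      ⟨colimit.isColimit (K ⋙ Pi.eval (fun _ => E) i)⟩
    exact ⟨⟨_, hc⟩⟩

instance isOmegaFunctor_extend (n : ℕ) [HasColimitsOfShape ℕ E] :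
    IsOmegaFunctor (extend E n) :=
  isOmegaFunctor_pi' _ (Fin.cases (isOmegaFunctor_snd) (fun i =>
    inferInstanceAs (IsOmegaFunctor
      (CategoryTheory.Prod.fst (Fin n → E) E ⋙ Pi.eval (fun _ => E) i))))

end Tuples

/-! ### The interpretations of types -/

namespace LNLModel

set_option linter.unusedSectionVars false

variable {C : Type u₁} [Category.{v₁} C] [CPOCategory C]
  [CartesianMonoidalCategory C] [BraidedCategory C] [HasFiniteCoproducts C]
  [CPOCartesian C] [CPOCoproducts C]
variable {L : Type u₂} [Category.{v₂} L] [CPOCategory L]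
  [MonoidalCategory L] [SymmetricCategory L] [MonoidalClosed L] [HasFiniteCoproducts L]
  [CPOMonoidalClosed L] [CPOCoproducts L] [HasEInitial L] [HasOmegaColimitsOfEmbeddings L]
variable (M : LNLModel C L)

/-- The standard interpretation `⟦Θ ⊢ A⟧ : L_e ^ |Θ| ⥤ L_e`. -/
noncomputable def lrb : ∀ {n : ℕ}, Ty n → (Fin n → Emb L) ⥤ Emb L
  | _, .var i => Pi.eval (fun _ => Emb L) i
  | _, .bang A => lrb A ⋙ M.bangE
  | _, .sum A B => (lrb A).prod' (lrb B) ⋙ sumE L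
  | _, .tensor A B => (lrb A).prod' (lrb B) ⋙ tensorE L
  | _, .lolli A B => (lrb A).prod' (lrb B) ⋙ lolliE L
  | n, .mu A => dagger (extend (Emb L) n ⋙ lrb A)

/-- `F_pe ^ n : C_pe ^ n ⥤ L_e ^ n`. -/
def Fpow (n : ℕ) : (Fin n → M.Cpe) ⥤ (Fin n → Emb L) := Functor.pi (fun _ => M.Fpe)

/-- The non-linear interpretation `C_pe ^ |Θ| ⥤ C_pe` of a non-linear type. -/
noncomputable def flrb : ∀ {n : ℕ} (P : Ty n), P.NonLinear → ((Fin n → M.Cpe) ⥤ M.Cpe)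
  | _, .var i, _ => Pi.eval (fun _ => M.Cpe) i
  | n, .bang A, _ => M.Fpow n ⋙ M.lrb A ⋙ M.Gpe
  | _, .sum P Q, h => (flrb P h.1).prod' (flrb Q h.2) ⋙ M.sumPe
  | _, .tensor P Q, h => (flrb P h.1).prod' (flrb Q h.2) ⋙ M.tensorPe
  | _, .lolli _ _, h => h.elim
  | n, .mu P, h => dagger (extend M.Cpe n ⋙ flrb P h)

instance isOmegaFunctor_Fpow (n : ℕ) : IsOmegaFunctor (M.Fpow n) :=
  isOmegaFunctor_pi' (fun i => Pi.eval (fun _ : Fin n => M.Cpe) i ⋙ M.Fpe)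
    (fun _ => inferInstance)

instance isOmegaFunctor_lrb {n : ℕ} (A : Ty n) : IsOmegaFunctor (M.lrb A) := by
  induction A with
  | var i => exact isOmegaFunctor_eval i
  | bang A ih =>
    have := ih
    exact inferInstanceAs (IsOmegaFunctor (M.lrb A ⋙ M.bangE))
  | sum A B ihA ihB =>
    have := ihA
    have := ihB
    exact inferInstanceAs (IsOmegaFunctor ((M.lrb A).prod' (M.lrb B) ⋙ sumE L))
  | tensor A B ihA ihB =>
    have := ihA
    have := ihB
    exact inferInstanceAs (IsOmegaFunctor ((M.lrb A).prod' (M.lrb B) ⋙ tensorE L))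
  | lolli A B ihA ihB =>
    have := ihA
    have := ihB
    exact inferInstanceAs (IsOmegaFunctor ((M.lrb A).prod' (M.lrb B) ⋙ lolliE L))
  | mu A ih =>
    have := ih
    exact isOmegaFunctor_dagger (extend (Emb L) _ ⋙ M.lrb A)

instance isOmegaFunctor_flrb {n : ℕ} (P : Ty n) (h : P.NonLinear) :
    IsOmegaFunctor (M.flrb P h) := by
  induction P with
  | var i => exact isOmegaFunctor_eval i
  | bang A => exact inferInstanceAs (IsOmegaFunctor (M.Fpow _ ⋙ M.lrb A ⋙ M.Gpe))
  | sum A B ihA ihB =>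
    have := ihA h.1
    have := ihB h.2
    exact inferInstanceAs (IsOmegaFunctor ((M.flrb A h.1).prod' (M.flrb B h.2) ⋙ M.sumPe))
  | tensor A B ihA ihB =>
    have := ihA h.1
    have := ihB h.2
    exact inferInstanceAs (IsOmegaFunctor ((M.flrb A h.1).prod' (M.flrb B h.2) ⋙ M.tensorPe))
  | lolli A B => exact h.elim
  | mu A ih =>
    have := ih h
    exact isOmegaFunctor_dagger (extend M.Cpe _ ⋙ M.flrb A h)

/-! #### Renaming and substitution -/

theorem lrb_rename {n : ℕ} (A : Ty n) : ∀ {m : ℕ} (ρ : Fin n → Fin m),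
    M.lrb (A.rename ρ) = reindex (Emb L) ρ ⋙ M.lrb A := by
  induction A with
  | var i => exact fun _ => rfl
  | bang A ih => exact fun ρ => congrArg (· ⋙ M.bangE) (ih ρ)
  | sum A B ihA ihB =>
    exact fun ρ => congrArg₂ (fun F G => Functor.prod' F G ⋙ sumE L) (ihA ρ) (ihB ρ)
  | tensor A B ihA ihB =>
    exact fun ρ => congrArg₂ (fun F G => Functor.prod' F G ⋙ tensorE L) (ihA ρ) (ihB ρ)
  | lolli A B ihA ihB =>
    exact fun ρ => congrArg₂ (fun F G => Functor.prod' F G ⋙ lolliE L) (ihA ρ) (ihB ρ)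
  | @mu n A ih =>
    intro m ρ
    refine Eq.trans ?_ (dagger_comp (reindex (Emb L) ρ) (extend (Emb L) n ⋙ M.lrb A))
    refine congrArg dagger ?_
    exact (congrArg (extend (Emb L) m ⋙ ·) (ih (Ty.liftRen ρ))).trans
      (congrArg (· ⋙ M.lrb A) (extend_reindex_liftRen ρ))

theorem lrb_subst {n : ℕ} (A : Ty n) : ∀ {m : ℕ} (σ : Fin n → Ty m),
    M.lrb (A.subst σ) = Functor.pi' (fun i => M.lrb (σ i)) ⋙ M.lrb A := by
  induction A with
  | var i => exact fun _ => rfl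
  | bang A ih => exact fun σ => congrArg (· ⋙ M.bangE) (ih σ)
  | sum A B ihA ihB =>
    exact fun σ => congrArg₂ (fun F G => Functor.prod' F G ⋙ sumE L) (ihA σ) (ihB σ)
  | tensor A B ihA ihB =>
    exact fun σ => congrArg₂ (fun F G => Functor.prod' F G ⋙ tensorE L) (ihA σ) (ihB σ)
  | lolli A B ihA ihB =>
    exact fun σ => congrArg₂ (fun F G => Functor.prod' F G ⋙ lolliE L) (ihA σ) (ihB σ)
  | @mu n A ih =>
    intro m σ
    refine Eq.trans ?_ (dagger_comp (Functor.pi' (fun i => M.lrb (σ i)))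
      (extend (Emb L) n ⋙ M.lrb A))
    refine congrArg dagger ?_
    exact (congrArg (extend (Emb L) m ⋙ ·) (ih (Ty.liftSub σ))).trans
      (congrArg (· ⋙ M.lrb A) (extend_pi' _ (fun i => M.lrb (Ty.liftSub σ i)) rfl
        (fun i => M.lrb_rename (σ i) Fin.succ)))

theorem flrb_rename {n : ℕ} (P : Ty n) (h : P.NonLinear) : ∀ {m : ℕ} (ρ : Fin n → Fin m),
    M.flrb (P.rename ρ) (h.rename ρ) = reindex M.Cpe ρ ⋙ M.flrb P h := by
  induction P with
  | var i => exact fun _ => rfl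
  | @bang n A => exact fun {m} ρ => congrArg (M.Fpow m ⋙ · ⋙ M.Gpe) (M.lrb_rename A ρ)
  | sum A B ihA ihB =>
    exact fun ρ => congrArg₂ (fun F G => Functor.prod' F G ⋙ M.sumPe) (ihA h.1 ρ) (ihB h.2 ρ)
  | tensor A B ihA ihB =>
    exact fun ρ => congrArg₂ (fun F G => Functor.prod' F G ⋙ M.tensorPe) (ihA h.1 ρ) (ihB h.2 ρ)
  | lolli A B => exact h.elim
  | @mu n A ih =>
    intro m ρ
    refine Eq.trans ?_ (dagger_comp (reindex M.Cpe ρ) (extend M.Cpe n ⋙ M.flrb A h))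
    refine congrArg dagger ?_
    exact (congrArg (extend M.Cpe m ⋙ ·) (ih h (Ty.liftRen ρ))).trans
      (congrArg (· ⋙ M.flrb A h) (extend_reindex_liftRen ρ))

/-- The equality `(|μY.P|) ∘ ⟨G₁, …, Gₙ⟩ = ((|P|) ∘ ⟨G₁, …, Gₙ, Y⟩)†`. -/
theorem flrb_liftSub {n m : ℕ} (P : Ty (n + 1)) (h : P.NonLinear) {σ : Fin n → Ty m}
    (hσ : ∀ i, (σ i).NonLinear) :
    dagger (extend M.Cpe m ⋙ Functor.pi' (fun i => M.flrb (Ty.liftSub σ i)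
      (Ty.NonLinear.liftSub hσ i)) ⋙ M.flrb P h) =
    Functor.pi' (fun i => M.flrb (σ i) (hσ i)) ⋙ dagger (extend M.Cpe n ⋙ M.flrb P h) := by
  refine Eq.trans ?_ (dagger_comp (Functor.pi' (fun i => M.flrb (σ i) (hσ i)))
    (extend M.Cpe n ⋙ M.flrb P h))
  refine congrArg dagger ?_
  exact congrArg (· ⋙ M.flrb P h) (extend_pi' _
    (fun i => M.flrb (Ty.liftSub σ i) (Ty.NonLinear.liftSub hσ i)) rfl
    (fun i => M.flrb_rename (σ i) (hσ i) Fin.succ))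

/-! #### The comparison isomorphisms -/

/-- The natural isomorphism `α : ⟦Θ ⊢ P⟧ ∘ F_pe ^ |Θ| ≅ F_pe ∘ (|Θ ⊢ P|)`. -/
noncomputable def alpha : ∀ {n : ℕ} (P : Ty n) (h : P.NonLinear),
    (M.Fpow n ⋙ M.lrb P ≅ M.flrb P h ⋙ M.Fpe)
  | n, .var i, _ => Iso.refl (Pi.eval (fun _ : Fin n => M.Cpe) i ⋙ M.Fpe)
  | n, .bang A, _ => Iso.refl (M.Fpow n ⋙ M.lrb A ⋙ M.bangE)
  | _, .sum P Q, h =>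
    Functor.isoWhiskerRight (prodIso (alpha P h.1) (alpha Q h.2)) (sumE L) ≪≫
      Functor.isoWhiskerLeft ((M.flrb P h.1).prod' (M.flrb Q h.2)) M.sumPeIso
  | _, .tensor P Q, h =>
    Functor.isoWhiskerRight (prodIso (alpha P h.1) (alpha Q h.2)) (tensorE L) ≪≫
      Functor.isoWhiskerLeft ((M.flrb P h.1).prod' (M.flrb Q h.2)) M.tensorPeIso
  | _, .lolli _ _, h => h.elim
  | n, .mu P, h => daggerSquareIso (N := M.Fpow n) (M := M.Fpe)
      (T := extend (Emb L) n ⋙ M.lrb P) (H := extend M.Cpe n ⋙ M.flrb P h)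
      (Functor.isoWhiskerRight (extendIso n M.Fpe) (M.lrb P) ≪≫
        Functor.isoWhiskerLeft (extend M.Cpe n) (alpha P h))

/-- The natural isomorphism `γ : (|P[σ]|) ≅ (|P|) ∘ ⟨(|σ₁|), …, (|σₙ|)⟩`. -/
noncomputable def gamma : ∀ {n m : ℕ} (P : Ty n) (h : P.NonLinear) (σ : Fin n → Ty m)
    (hσ : ∀ i, (σ i).NonLinear),
    (M.flrb (P.subst σ) (h.subst hσ) ≅ Functor.pi' (fun i => M.flrb (σ i) (hσ i)) ⋙ M.flrb P h)
  | _, _, .var i, _, σ, hσ => Iso.refl (M.flrb (σ i) (hσ i))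
  | _, m, .bang A, _, σ, hσ =>
    Functor.isoWhiskerLeft (M.Fpow m)
        (Functor.isoWhiskerRight (eqToIso (M.lrb_subst A σ)) M.Gpe) ≪≫
      Functor.isoWhiskerRight (tupIso (fun i => M.alpha (σ i) (hσ i))) (M.lrb A ⋙ M.Gpe)
  | _, _, .sum P Q, h, σ, hσ =>
    Functor.isoWhiskerRight (prodIso (gamma P h.1 σ hσ) (gamma Q h.2 σ hσ)) M.sumPe
  | _, _, .tensor P Q, h, σ, hσ =>
    Functor.isoWhiskerRight (prodIso (gamma P h.1 σ hσ) (gamma Q h.2 σ hσ)) M.tensorPe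
  | _, _, .lolli _ _, h, _, _ => h.elim
  | _, m, .mu P, h, σ, hσ =>
    daggerMapIso (Functor.isoWhiskerLeft (extend M.Cpe m)
        (gamma P h (Ty.liftSub σ) (Ty.NonLinear.liftSub hσ))) ≪≫
      eqToIso (M.flrb_liftSub P h hσ)

/-! #### Folding -/

/-- `⟨Id, ⟦B⟧⟩` as the tuple of the interpretations of the substitution `[B / X]`. -/
theorem lrb_single {n : ℕ} (B : Ty n) :
    Functor.pi' (fun i => M.lrb (Ty.single B i)) =
      (𝟭 _).prod' (M.lrb B) ⋙ extend (Emb L) n :=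
  Functor.pi_ext _ _ (Fin.cases rfl (fun _ => rfl))

theorem flrb_single {n : ℕ} (B : Ty n) (h : B.NonLinear) :
    Functor.pi' (fun i => M.flrb (Ty.single B i) (Ty.NonLinear.single h i)) =
      (𝟭 _).prod' (M.flrb B h) ⋙ extend M.Cpe n :=
  Functor.pi_ext _ _ (Fin.cases rfl (fun _ => rfl))

/-- The substitution lemma `⟦Θ ⊢ A[B / X]⟧ = ⟦Θ, X ⊢ A⟧ ∘ ⟨Id, ⟦Θ ⊢ B⟧⟩`. -/
theorem lrb_inst {n : ℕ} (A : Ty (n + 1)) (B : Ty n) :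
    M.lrb (A.inst B) = (𝟭 _).prod' (M.lrb B) ⋙ extend (Emb L) n ⋙ M.lrb A :=
  (M.lrb_subst A (Ty.single B)).trans (congrArg (· ⋙ M.lrb A) (M.lrb_single B))

/-- The natural isomorphism `γ : (|Θ ⊢ P[R / X]|) ≅ (|Θ, X ⊢ P|) ∘ ⟨Id, (|Θ ⊢ R|)⟩`. -/
noncomputable def gammaInst {n : ℕ} (P : Ty (n + 1)) (hP : P.NonLinear) (R : Ty n)
    (hR : R.NonLinear) : M.flrb (P.inst R) (hP.inst hR) ≅
      (𝟭 _).prod' (M.flrb R hR) ⋙ extend M.Cpe n ⋙ M.flrb P hP :=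
  M.gamma P hP (Ty.single R) (Ty.NonLinear.single hR) ≪≫
    Functor.isoWhiskerRight (eqToIso (M.flrb_single R hR)) (M.flrb P hP)

/-- The standard folding `⟦Θ ⊢ A[μX.A / X]⟧ ≅ ⟦Θ ⊢ μX.A⟧`. -/
noncomputable def fold {n : ℕ} (A : Ty (n + 1)) : M.lrb (A.inst A.mu) ≅ M.lrb A.mu :=
  eqToIso (M.lrb_inst A A.mu) ≪≫ daggerIso (extend (Emb L) n ⋙ M.lrb A)

/-- The non-linear folding `(|Θ ⊢ P[μX.P / X]|) ≅ (|Θ ⊢ μX.P|)`. -/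
noncomputable def nlFold {n : ℕ} (P : Ty (n + 1)) (h : P.mu.NonLinear) :
    M.flrb (P.inst P.mu) (h.body.inst h) ≅ M.flrb P.mu h :=
  M.gammaInst P h.body P.mu h ≪≫ daggerIso (extend M.Cpe n ⋙ M.flrb P h.body)

end LNLModel

end LNLFPC

/-! Each folding map is a substitution step followed by the structure map `φ` of a parameterised
initial algebra. The substitution step is an equality of functors for the standard interpretation
and the isomorphism `γ` for the non-linear one. The required square is therefore pasted from two
squares, one for `φ` and one for substitution.

The square for `φ`. Fix a parameter tuple `X` and put `T = ⟦P⟧(F X, -)`, `H = (|P|)(X, -)`, `M =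
F_pe`. The comparison `α` at `μX.P` is the colimit of maps `T ^ n ∅ ⟶ M (H ^ n ∅)` built by
iterating `α` at `P`. Such a colimit is a morphism of `T`-algebras from the initial `T`-algebra to
the `M`-image of the initial `H`-algebra, because the structure maps only shift the stage from `n`
to `n + 1` (`initAlgIso_hom_comp`, specialised in `daggerIso_comp_alpha_mu`).

The square for substitution. By induction on `P`, `α` at `P[σ]` followed by `F γ` equals `⟦P⟧`
applied to the tuple of the `α` at `σ i`, followed by `α` at `P` (`alpha_subst`). Simultaneous
substitutions are needed because passing under a binder replaces `σ` by its lift. The case `!A`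
holds by the choice of `γ`, the cases `+` and `⊗` by naturality of `β`. The case `μ` holds because
the colimit of the iterated comparison is natural in the pair of endofunctors (`comp_map_initAlg`):
a compatible pair of transformations of the bodies induces a commuting square of initial algebras. A
lifted substitution weakens each `σ i`, so the same statement for renamings comes first
(`alpha_rename`).

Substitution and renaming hold for the standard interpretation as propositional equalities of
functors, and so does renaming for the non-linear one; transports `eqToHom` thus appear in all
squares. They are factored into a change of functor, absorbed by the inductive hypothesis, and a
change of the argument tuple, absorbed by naturality of `α` and compared one component at a time. -/

namespace LNLFPC

/-! ### Comparing initial algebras of endofunctors on two categories -/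

section InitialAlgebras

variable {B : Type u₁} [Category.{v₁} B] {D : Type u₂} [Category.{v₂} D]
variable [HasInitial B] [HasInitial D]

/-- The comparison `T ^ n ∅ ⟶ M (H ^ n ∅)` induced by a natural transformation
`T ∘ M ⟶ M ∘ H`. -/
noncomputable def squareIter {M : B ⥤ D} {T : D ⥤ D} {H : B ⥤ B} (α : M ⋙ T ⟶ H ⋙ M) :
    ∀ n, iterObj T n ⟶ M.obj (iterObj H n)
  | 0 => initial.to _
  | n + 1 => T.map (squareIter α n) ≫ α.app (iterObj H n)

/-- The hypothesis `w` says that `τ` and `η` carry the square `α` to the square `α'`. Stage `0` is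
forced because both sides leave the initial object; the successor stage pastes naturality of `τ`,
the previous stage, naturality of `α` and `w`. Nothing is asked of `M`, since only the source of the
comparison has to start at an initial object. -/
theorem squareIter_comp_map {M : B ⥤ D} {T T' : D ⥤ D} {H H' : B ⥤ B} {α : M ⋙ T ⟶ H ⋙ M}
    {α' : M ⋙ T' ⟶ H' ⋙ M} {τ : T ⟶ T'} {η : H ⟶ H'}
    (w : ∀ b, α.app b ≫ M.map (η.app b) = τ.app (M.obj b) ≫ α'.app b) (n : ℕ) :
    squareIter α n ≫ M.map (iterMap η n) = iterMap τ n ≫ squareIter α' n := by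
  induction n with
  | zero => exact initialIsInitial.hom_ext _ _
  | succ n ih =>
    have hα := α.naturality (iterMap η n)
    dsimp at hα
    change (T.map (squareIter α n) ≫ α.app _) ≫ M.map (H.map (iterMap η n) ≫ η.app _) =
      (T.map (iterMap τ n) ≫ τ.app _) ≫ T'.map (squareIter α' n) ≫ α'.app _
    rw [Category.assoc, Category.assoc, ← τ.naturality_assoc, ← T.map_comp_assoc, ← ih, M.map_comp,
      ← reassoc_of% hα, T.map_comp_assoc, w]

variable [HasColimitsOfShape ℕ B] [HasColimitsOfShape ℕ D]

theorem initAlg_hom_ext {T : B ⥤ B} {X : B} {f g : (initAlg B).obj T ⟶ X}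
    (h : ∀ n, seqι T n ≫ f = seqι T n ≫ g) : f = g :=
  colimit.hom_ext h

/-- The passage of `squareIter_comp_map` to the colimit. The maps `s` and `s'` enter only through
their values on the colimit injections, and no parameter categories are mentioned, so the two
squares may come from contexts of different lengths. -/
theorem comp_map_initAlg {M : B ⥤ D} {T T' : D ⥤ D} {H H' : B ⥤ B} {α : M ⋙ T ⟶ H ⋙ M}
    {α' : M ⋙ T' ⟶ H' ⋙ M} {τ : T ⟶ T'} {η : H ⟶ H'}
    (w : ∀ b, α.app b ≫ M.map (η.app b) = τ.app (M.obj b) ≫ α'.app b)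
    {s : (initAlg D).obj T ⟶ M.obj ((initAlg B).obj H)}
    {s' : (initAlg D).obj T' ⟶ M.obj ((initAlg B).obj H')}
    (hs : ∀ n, seqι T n ≫ s = squareIter α n ≫ M.map (seqι H n))
    (hs' : ∀ n, seqι T' n ≫ s' = squareIter α' n ≫ M.map (seqι H' n)) :
    s ≫ M.map ((initAlg B).map η) = (initAlg D).map τ ≫ s' := by
  refine initAlg_hom_ext fun n => ?_
  rw [reassoc_of% hs, ← M.map_comp, seqι_comp_map, M.map_comp, ← Category.assoc,
    squareIter_comp_map w, ← Category.assoc, seqι_comp_map, Category.assoc, Category.assoc, hs']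

/-- The map `s` is a morphism of `T`-algebras out of the initial one; the target carries the
structure `α` followed by the `M`-image of the structure map for `H`. As `T` preserves the colimit,
it suffices to test on the maps `T.map (seqι T n)`, where both structure maps move stage `n` to
stage `n + 1`. -/
theorem initAlgIso_hom_comp {M : B ⥤ D} {T : D ⥤ D} {H : B ⥤ B} [IsOmegaFunctor T]
    [IsOmegaFunctor H] {α : M ⋙ T ⟶ H ⋙ M}
    {s : (initAlg D).obj T ⟶ M.obj ((initAlg B).obj H)}
    (hs : ∀ n, seqι T n ≫ s = squareIter α n ≫ M.map (seqι H n)) :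
    (initAlgIso T).hom ≫ s = T.map s ≫ α.app _ ≫ M.map (initAlgIso H).hom := by
  refine map_initAlg_hom_ext T fun n => ?_
  have hα := α.naturality (seqι H n)
  dsimp at hα
  rw [← T.map_comp_assoc, hs, T.map_comp_assoc, reassoc_of% hα, ← M.map_comp,
    map_seqι_comp_initAlgIso_hom, ← Category.assoc, map_seqι_comp_initAlgIso_hom]
  -- By definition `squareIter α (n + 1)` is `T.map (squareIter α n)` followed by `α`, so what is
  -- left is the description of `s` at the next stage.
  exact (hs (n + 1)).trans (Category.assoc _ _ _)

end InitialAlgebras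

/-! ### The isomorphism `α†` on colimit injections -/

section DaggerSquare

variable {A : Type u₁} [Category.{v₁} A] {B : Type u₂} [Category.{v₂} B]
variable {C : Type u₃} [Category.{v₃} C] {D : Type u₄} [Category.{v₄} D]
-- Reparametrising a family of endofunctors along `K` is precomposition with `K`. The equality is
-- not definitional: the action on the second argument involves `K.map (𝟙 a)` on the left and `𝟙
-- (K.obj a)` on the right.
theorem curry_prod_comp (K : A ⥤ C) (T : C × D ⥤ D) :
    Functor.curry.obj (K.prod (𝟭 D) ⋙ T) = K ⋙ Functor.curry.obj T := by
  refine CategoryTheory.Functor.ext (fun a => CategoryTheory.Functor.ext (fun b => rfl) ?_) ?_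
  · intro X Y f
    simp
  · intro X Y f
    ext b
    simp

variable {N : A ⥤ C} {M : B ⥤ D} {T : C × D ⥤ D} {H : A × B ⥤ B}

/-- The natural transformation `T (N a, M -) ⟶ M (H (a, -))` given by `α`. -/
def squareTrans (α : N.prod M ⋙ T ≅ H ⋙ M) (a : A) :
    M ⋙ (Functor.curry.obj T).obj (N.obj a) ⟶ (Functor.curry.obj H).obj a ⋙ M where
  app b := (squareApp α a b).hom
  naturality _ _ g := squareApp_naturality_right α a g

variable [HasInitial B] [HasInitial D] [PreservesColimit (Functor.empty.{0} B) M]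

/-- The two recursions have the same successor step, and at stage `0` a map out of the initial
object is unique. This makes the results on plain natural transformations available for `α*`. -/
theorem starApp_hom (α : N.prod M ⋙ T ≅ H ⋙ M) (a : A) (n : ℕ) :
    (starApp α a n).hom = squareIter (squareTrans α a) n := by
  induction n with
  | zero => exact initialIsInitial.hom_ext _ _
  | succ n ih =>
    exact congrArg (fun k => ((Functor.curry.obj T).obj (N.obj a)).map k ≫ _) ih

variable [HasColimitsOfShape ℕ B] [HasColimitsOfShape ℕ D]

/-- Supplies the hypothesis `hs` of the lemmas on initial algebras. The map `α†` is the colimit of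
`α*` followed by the inverse of the isomorphism expressing that `M` preserves the colimit, and both
factors are known on the injections. -/
theorem seqι_comp_daggerSquareIso [IsOmegaFunctor M] (α : N.prod M ⋙ T ≅ H ⋙ M) (a : A) (n : ℕ) :
    seqι ((Functor.curry.obj T).obj (N.obj a)) n ≫ (daggerSquareIso α).hom.app a =
      squareIter (squareTrans α a) n ≫ M.map (seqι ((Functor.curry.obj H).obj a) n) := by
  rw [← starApp_hom]
  refine (Category.assoc _ _ _).symm.trans ?_
  refine (congrArg (· ≫ _) (ι_colimMap ((starIso α).hom.app a) n)).trans ?_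
  refine (Category.assoc _ _ _).trans (congrArg ((starApp α a n).hom ≫ ·) ?_)
  exact ι_preservesColimitIso_inv M ((seqFunctor B).obj ((Functor.curry.obj H).obj a)) n

end DaggerSquare

/-! ### Transports along equalities and pasting of squares -/

theorem map_comp_eqToHom {A : Type u₁} [Category.{v₁} A] {B : Type u₂} [Category.{v₂} B]
    {F G : A ⥤ B} (h : F = G) {X Y : A} (f : X ⟶ Y) :
    F.map f ≫ eqToHom (Functor.congr_obj h Y) = eqToHom (Functor.congr_obj h X) ≫ G.map f := by
  subst h; simp

/-- A transport depends only on its endpoints, so it may be routed through any intermediate object.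
Here it separates the change of functor (`h₁`) from the change of argument (`h₂`). -/
theorem eqToHom_eq_comp_map {A : Type u₁} [Category.{v₁} A] {B : Type u₂} [Category.{v₂} B]
    (F : A ⥤ B) {b : B} {a a' : A} (h₁ : b = F.obj a) (h₂ : a = a') (h : b = F.obj a') :
    eqToHom h = eqToHom h₁ ≫ F.map (eqToHom h₂) := by
  subst h₂; simp

theorem eqToHom_eq_map_mkHom {A : Type u₁} [Category.{v₁} A] {B : Type u₂} [Category.{v₂} B]
    {E : Type u₃} [Category.{v₃} E] (T : A × B ⥤ E) {a a' : A} {b b' : B} (ha : a = a')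
    (hb : b = b') (h : T.obj (a, b) = T.obj (a', b')) :
    eqToHom h = T.map (Prod.mkHom (eqToHom ha) (eqToHom hb)) := by
  subst ha hb; exact (T.map_id _).symm

theorem map_eqToHom_apply {A : Type u₁} [Category.{v₁} A] {B : Type u₂} [Category.{v₂} B]
    (F : A ⥤ B) {I : Type} {x y : I → A} (h : x = y) (i : I) :
    F.map ((eqToHom h : x ⟶ y) i) = eqToHom (congrArg (fun z => F.obj (z i)) h) := by
  subst h; exact F.map_id _

theorem map_mkHom_comp_comp {A : Type u₁} [Category.{v₁} A] {B : Type u₂} [Category.{v₂} B]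
    {E : Type u₃} [Category.{v₃} E] (T : A × B ⥤ E) {a₁ a₂ a₃ : A} {b₁ b₂ b₃ : B} {e : E}
    (f : a₁ ⟶ a₂) (g : a₂ ⟶ a₃) (f' : b₁ ⟶ b₂) (g' : b₂ ⟶ b₃) (k : T.obj (a₃, b₃) ⟶ e) :
    T.map (Prod.mkHom (f ≫ g) (f' ≫ g')) ≫ k =
      T.map (Prod.mkHom f f') ≫ T.map (Prod.mkHom g g') ≫ k :=
  (congrArg (· ≫ k) (T.map_comp (Prod.mkHom f f') (Prod.mkHom g g'))).trans (Category.assoc _ _ _)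

/-- The pairing of two commuting squares, pasted with a natural transformation of bifunctors. -/
theorem map_mkHom_comp_app_comp {B : Type u₁} [Category.{v₁} B] {E : Type u₂} [Category.{v₂} E]
    {M : B ⥤ E} {S : E × E ⥤ E} {T : B × B ⥤ B} (β : M.prod M ⋙ S ⟶ T ⋙ M)
    {x x' y y' : B} {a a' c c' : E} {p : a ⟶ M.obj x} {p' : a' ⟶ M.obj x'}
    {r : x ⟶ y} {r' : x' ⟶ y'} {s : a ⟶ c} {s' : a' ⟶ c'}
    {u : c ⟶ M.obj y} {u' : c' ⟶ M.obj y'} {r₀ : T.obj (x, x') ⟶ T.obj (y, y')}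
    {s₀ : S.obj (a, a') ⟶ S.obj (c, c')} (hr : r₀ = T.map (Prod.mkHom r r'))
    (hs : s₀ = S.map (Prod.mkHom s s')) (h : p ≫ M.map r = s ≫ u)
    (h' : p' ≫ M.map r' = s' ≫ u') :
    (S.map (Prod.mkHom p p') ≫ β.app (x, x')) ≫ M.map r₀ =
      s₀ ≫ S.map (Prod.mkHom u u') ≫ β.app (y, y') := by
  subst hr hs
  have hβ := β.naturality (X := (x, x')) (Y := (y, y')) (Prod.mkHom r r')
  have e : S.map (Prod.mkHom p p') ≫ S.map (Prod.mkHom (M.map r) (M.map r')) =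
      S.map (Prod.mkHom s s') ≫ S.map (Prod.mkHom u u') :=
    (S.map_comp _ _).symm.trans ((congrArg S.map (Prod.ext h h')).trans (S.map_comp _ _))
  refine (Category.assoc _ _ _).trans ((congrArg (_ ≫ ·) hβ.symm).trans ?_)
  refine (Category.assoc _ _ _).symm.trans ((congrArg (· ≫ β.app (y, y')) e).trans ?_)
  exact Category.assoc _ _ _

/-- The pasting of two commuting squares along a common edge, with factored sides. -/
theorem comp_comp_eq_of_squares {E : Type u₁} [Category.{v₁} E] {a₀ a₁ a₂ a₃ b₀ b₁ b₂ c₁ c₂ : E}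
    {p : a₀ ⟶ a₁} {q : a₁ ⟶ a₂} {r : a₂ ⟶ a₃} {s : a₀ ⟶ c₁} {t : c₁ ⟶ c₂} {u : c₂ ⟶ a₃}
    {x₀ : a₀ ⟶ b₀} {x : a₁ ⟶ b₁} {z : b₀ ⟶ b₁} {q' : b₁ ⟶ b₂} {r₁ : a₂ ⟶ b₂} {r₂ : b₂ ⟶ a₃}
    {y : b₁ ⟶ c₂} {w : b₀ ⟶ c₁} (hr : r = r₁ ≫ r₂) (hq : q ≫ r₁ = x ≫ q')
    (hq' : q' ≫ r₂ = y ≫ u) (hp : p ≫ x = x₀ ≫ z) (hs : s = x₀ ≫ w) (hz : z ≫ y = w ≫ t) :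
    (p ≫ q) ≫ r = s ≫ t ≫ u := by
  subst hr hs
  rw [Category.assoc, reassoc_of% hq, hq', reassoc_of% hp, reassoc_of% hz, Category.assoc]

/-! ### Comparison isomorphisms at recursive types -/

namespace LNLModel

set_option linter.unusedSectionVars false

variable {C : Type u₁} [Category.{v₁} C] [CPOCategory C]
  [CartesianMonoidalCategory C] [BraidedCategory C] [HasFiniteCoproducts C]
  [CPOCartesian C] [CPOCoproducts C]
variable {L : Type u₂} [Category.{v₂} L] [CPOCategory L]
  [MonoidalCategory L] [SymmetricCategory L] [MonoidalClosed L] [HasFiniteCoproducts L]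
  [CPOMonoidalClosed L] [CPOCoproducts L] [HasEInitial L] [HasOmegaColimitsOfEmbeddings L]
variable (M : LNLModel C L)

/-- The square whose mediating isomorphism is `α` at `μX.P`. -/
noncomputable def alphaBody {n : ℕ} (P : Ty (n + 1)) (h : P.NonLinear) :
    (M.Fpow n).prod M.Fpe ⋙ extend (Emb L) n ⋙ M.lrb P ≅
      (extend M.Cpe n ⋙ M.flrb P h) ⋙ M.Fpe :=
  Functor.isoWhiskerRight (extendIso n M.Fpe) (M.lrb P) ≪≫
    Functor.isoWhiskerLeft (extend M.Cpe n) (M.alpha P h)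

/-- Morphisms of endofunctors that commute with the body squares induce a commuting square between
the comparison isomorphisms of recursive types. -/
theorem alpha_mu_app_comp {n m : ℕ} {P : Ty (n + 1)} {h : P.NonLinear} {P' : Ty (m + 1)}
    {h' : P'.NonLinear} {X : Fin n → M.Cpe} {X' : Fin m → M.Cpe}
    {τ : (Functor.curry.obj (extend (Emb L) n ⋙ M.lrb P)).obj ((M.Fpow n).obj X) ⟶
      (Functor.curry.obj (extend (Emb L) m ⋙ M.lrb P')).obj ((M.Fpow m).obj X')}
    {η : (Functor.curry.obj (extend M.Cpe n ⋙ M.flrb P h)).obj X ⟶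
      (Functor.curry.obj (extend M.Cpe m ⋙ M.flrb P' h')).obj X'}
    (w : ∀ Y : M.Cpe,
      ((M.lrb P).map ((extendIso n M.Fpe).hom.app (X, Y)) ≫
        (M.alpha P h).hom.app ((extend M.Cpe n).obj (X, Y))) ≫ M.Fpe.map (η.app Y) =
      τ.app (M.Fpe.obj Y) ≫ (M.lrb P').map ((extendIso m M.Fpe).hom.app (X', Y)) ≫
        (M.alpha P' h').hom.app ((extend M.Cpe m).obj (X', Y))) :
    (M.alpha P.mu h).hom.app X ≫ M.Fpe.map ((initAlg M.Cpe).map η) =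
      (initAlg (Emb L)).map τ ≫ (M.alpha P'.mu h').hom.app X' :=
  -- The isomorphism `α` at `μX.P` unfolds to the dagger of `alphaBody`, and `w` unfolds to the
  -- compatibility condition between the two body squares at the parameters `X` and `X'`.
  comp_map_initAlg (α := squareTrans (M.alphaBody P h) X)
    (α' := squareTrans (M.alphaBody P' h') X') w
    (seqι_comp_daggerSquareIso _ X) (seqι_comp_daggerSquareIso _ X')

/-- The half of the theorem that concerns `φ`: the component of `α` at `μX.P` is a morphism of
algebras for the endofunctor `⟦P⟧(F X, -)`. No substitution is involved yet. -/
theorem daggerIso_comp_alpha_mu {n : ℕ} (P : Ty (n + 1)) (h : P.mu.NonLinear)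
    (X : Fin n → M.Cpe) :
    (daggerIso (extend (Emb L) n ⋙ M.lrb P)).hom.app ((M.Fpow n).obj X) ≫
        (M.alpha P.mu h).hom.app X =
      (M.lrb P).map ((extend (Emb L) n).map
          (Prod.mkHom (𝟙 ((M.Fpow n).obj X)) ((M.alpha P.mu h).hom.app X))) ≫
        ((M.lrb P).map ((extendIso n M.Fpe).hom.app (X, (M.flrb P.mu h).obj X)) ≫
          (M.alpha P h.body).hom.app ((extend M.Cpe n).obj (X, (M.flrb P.mu h).obj X))) ≫
        M.Fpe.map ((daggerIso (extend M.Cpe n ⋙ M.flrb P h.body)).hom.app X) :=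
  initAlgIso_hom_comp (M := M.Fpe) (seqι_comp_daggerSquareIso (M.alphaBody P h.body) X)

/-! ### Induction on types: renaming, then substitution -/

/-- The comparison isomorphisms are stable under renaming of type variables. -/
theorem alpha_rename {n : ℕ} (P : Ty n) (h : P.NonLinear) : ∀ {m : ℕ} (ρ : Fin n → Fin m)
    (X : Fin m → M.Cpe),
    (M.alpha (P.rename ρ) (h.rename ρ)).hom.app X ≫
        M.Fpe.map (eqToHom (Functor.congr_obj (M.flrb_rename P h ρ) X)) =
      eqToHom (Functor.congr_obj (M.lrb_rename P ρ) ((M.Fpow m).obj X)) ≫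
        (M.alpha P h).hom.app ((reindex M.Cpe ρ).obj X) := by
  induction P with
  | var i =>
    exact fun ρ X => (congrArg (𝟙 (M.Fpe.obj (X (ρ i))) ≫ ·) (M.Fpe.map_id (X (ρ i)))).trans rfl
  | @bang n A =>
    intro m ρ X
    -- Both comparisons at a type `!A` are identities, so it remains that `F_pe` sends a transport
    -- to a transport.
    refine (Category.id_comp _).trans (Eq.trans ?_ (Category.comp_id _).symm)
    exact eqToHom_map M.Fpe _
  | sum A B ihA ihB =>
    exact fun ρ X => map_mkHom_comp_app_comp M.sumPeIso.hom (eqToHom_eq_map_mkHom M.sumPe _ _ _)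
      (eqToHom_eq_map_mkHom (sumE L) (Functor.congr_obj (M.lrb_rename A ρ) _)
        (Functor.congr_obj (M.lrb_rename B ρ) _) _) (ihA h.1 ρ X) (ihB h.2 ρ X)
  | tensor A B ihA ihB =>
    exact fun ρ X => map_mkHom_comp_app_comp M.tensorPeIso.hom (eqToHom_eq_map_mkHom M.tensorPe _ _ _)
      (eqToHom_eq_map_mkHom (tensorE L) (Functor.congr_obj (M.lrb_rename A ρ) _)
        (Functor.congr_obj (M.lrb_rename B ρ) _) _) (ihA h.1 ρ X) (ihB h.2 ρ X)
  | lolli A B => exact h.elim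
  | @mu n P ih =>
    intro m ρ X
    -- At a fixed parameter, the renamed body and the original body at the reindexed parameter are
    -- equal endofunctors, on either side. The transports along these equalities serve as `τ` and
    -- `η`; the functor `initAlg` turns them into transports between the carriers.
    have h₁ : (Functor.curry.obj (extend (Emb L) m ⋙ M.lrb (P.rename (Ty.liftRen ρ)))).obj
        ((M.Fpow m).obj X) = (Functor.curry.obj (extend (Emb L) n ⋙ M.lrb P)).obj
          ((M.Fpow n).obj ((reindex M.Cpe ρ).obj X)) := by
      rw [M.lrb_rename, ← Functor.assoc, extend_reindex_liftRen, Functor.assoc, curry_prod_comp]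
      rfl
    have h₂ : (Functor.curry.obj (extend M.Cpe m ⋙ M.flrb (P.rename (Ty.liftRen ρ))
        (Ty.NonLinear.rename h.body _))).obj X =
          (Functor.curry.obj (extend M.Cpe n ⋙ M.flrb P h)).obj ((reindex M.Cpe ρ).obj X) := by
      rw [M.flrb_rename P h.body, ← Functor.assoc, extend_reindex_liftRen, Functor.assoc,
        curry_prod_comp]
      rfl
    have key := M.alpha_mu_app_comp (τ := eqToHom h₁) (η := eqToHom h₂) (fun Y => ?_)
    · rw [eqToHom_map, eqToHom_map] at key
      exact key
    -- The transport `η` is split into the renaming of `P`, handled by the inductive hypothesis, and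
    -- the rearrangement of the extended tuple, handled by naturality of `α` at `P`. The transport
    -- `τ` is split in the same way. What remains is an equation between morphisms of tuples under
    -- `⟦P⟧`.
    · refine comp_comp_eq_of_squares
        (r₂ := M.Fpe.map ((M.flrb P h).map
          (eqToHom (Functor.congr_obj (extend_reindex_liftRen ρ) (X, Y)))))
        (w := (M.lrb P).map
          (eqToHom (Functor.congr_obj (extend_reindex_liftRen ρ) ((M.Fpow m).obj X, M.Fpe.obj Y))))
        ?_ (ih h (Ty.liftRen ρ) ((extend M.Cpe m).obj (X, Y)))
        ((M.alpha P h).hom.naturality _).symm (map_comp_eqToHom (M.lrb_rename P _) _) ?_ ?_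
      · refine Eq.trans (congrArg M.Fpe.map ?_) (M.Fpe.map_comp _ _)
        exact (eqToHom_app h₂ Y).trans (eqToHom_eq_comp_map (M.flrb P h) _ _ _)
      · exact (eqToHom_app h₁ _).trans (eqToHom_eq_comp_map (M.lrb P) _ _ _)
      · refine ((M.lrb P).map_comp _ _).symm.trans
          (Eq.trans (congrArg (M.lrb P).map ?_) ((M.lrb P).map_comp _ _))
        have e₁ (i : Fin (n + 1)) :
            M.Fpe.map ((eqToHom (Functor.congr_obj (extend_reindex_liftRen ρ) (X, Y)) :
              (extend M.Cpe m ⋙ reindex M.Cpe (Ty.liftRen ρ)).obj (X, Y) ⟶ _) i) = eqToHom _ :=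
          map_eqToHom_apply M.Fpe _ i
        have e₂ (i : Fin (n + 1)) :
            (eqToHom (Functor.congr_obj (extend_reindex_liftRen ρ) ((M.Fpow m).obj X, M.Fpe.obj Y)) :
              (extend (Emb L) m ⋙ reindex (Emb L) (Ty.liftRen ρ)).obj _ ⟶ _) i = eqToHom _ :=
          Functor.eqToHom_proj _ i
        -- The components of `extendIso` are identities, so in each component both sides are
        -- transports with the same endpoints.
        refine funext (Fin.cases ?_ fun i => ?_)
        · exact (Category.id_comp _).trans ((e₁ 0).trans
            ((e₂ 0).symm.trans (Category.comp_id _).symm))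
        · exact (Category.id_comp _).trans ((e₁ i.succ).trans
            ((e₂ i.succ).symm.trans (Category.comp_id _).symm))

/-- The comparison isomorphisms are compatible with substitution. -/
theorem alpha_subst {n : ℕ} (P : Ty n) (h : P.NonLinear) : ∀ {m : ℕ} (σ : Fin n → Ty m)
    (hσ : ∀ i, (σ i).NonLinear) (X : Fin m → M.Cpe),
    (M.alpha (P.subst σ) (h.subst hσ)).hom.app X ≫ M.Fpe.map ((M.gamma P h σ hσ).hom.app X) =
      eqToHom (Functor.congr_obj (M.lrb_subst P σ) ((M.Fpow m).obj X)) ≫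
        (M.lrb P).map (fun i => (M.alpha (σ i) (hσ i)).hom.app X) ≫
        (M.alpha P h).hom.app (fun i => (M.flrb (σ i) (hσ i)).obj X) := by
  induction P with
  | var i =>
    intro m σ hσ X
    refine (congrArg (_ ≫ ·) (M.Fpe.map_id _)).trans ((Category.comp_id _).trans ?_)
    exact ((Category.id_comp _).trans (Category.comp_id _)).symm
  | @bang n A =>
    intro m σ hσ X
    refine (Category.id_comp _).trans (Eq.trans ?_ (congrArg (_ ≫ ·) (Category.comp_id _).symm))
    -- Here `γ` is, up to the transport for `A[σ]`, the image under `G_pe` of `⟦A⟧` applied to the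
    -- tuple of comparisons. Applying `F_pe` gives the image under `!_e`, as required, since the
    -- comparisons at `!`-types are identities.
    refine (M.Fpe.map_comp _ _).trans (congrArg₂ (· ≫ ·) ?_ rfl)
    refine (congrArg (M.Gpe ⋙ M.Fpe).map
      (eqToHom_app (M.lrb_subst A σ) ((M.Fpow m).obj X))).trans ?_
    exact eqToHom_map (M.Gpe ⋙ M.Fpe) _
  | sum A B ihA ihB =>
    intro m σ hσ X
    -- The map `γ` is already a pair, hence `rfl`; only the transport on the linear side has to be
    -- written as one. The pair of composites obtained on the right is then split by functoriality.
    refine (map_mkHom_comp_app_comp M.sumPeIso.hom rfl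
      (eqToHom_eq_map_mkHom (sumE L) (Functor.congr_obj (M.lrb_subst A σ) _)
        (Functor.congr_obj (M.lrb_subst B σ) _) _) (ihA h.1 σ hσ X) (ihB h.2 σ hσ X)).trans
      (congrArg (_ ≫ ·) ?_)
    exact map_mkHom_comp_comp (sumE L) _ _ _ _ _
  | tensor A B ihA ihB =>
    intro m σ hσ X
    refine (map_mkHom_comp_app_comp M.tensorPeIso.hom rfl
      (eqToHom_eq_map_mkHom (tensorE L) (Functor.congr_obj (M.lrb_subst A σ) _)
        (Functor.congr_obj (M.lrb_subst B σ) _) _) (ihA h.1 σ hσ X) (ihB h.2 σ hσ X)).trans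
      (congrArg (_ ≫ ·) ?_)
    exact map_mkHom_comp_comp (tensorE L) _ _ _ _ _
  | lolli A B => exact h.elim
  | @mu n P ih =>
    intro m σ hσ X
    -- Under the binder, the tuple interpreting the lifted substitution is the tuple for `σ` on the
    -- old variables, up to weakening, together with the identity on the new one.
    have e₁ := extend_pi' (E := Emb L) (fun i => M.lrb (σ i)) (fun i => M.lrb (Ty.liftSub σ i)) rfl
      (fun i => M.lrb_rename (σ i) Fin.succ)
    have e₂ := extend_pi' (fun i => M.flrb (σ i) (hσ i))
      (fun i => M.flrb (Ty.liftSub σ i) (Ty.NonLinear.liftSub hσ i)) rfl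
      (fun i => M.flrb_rename (σ i) (hσ i) Fin.succ)
    have h₁ : (Functor.curry.obj (extend (Emb L) m ⋙ M.lrb (P.subst (Ty.liftSub σ)))).obj
        ((M.Fpow m).obj X) = (Functor.curry.obj (extend (Emb L) n ⋙ M.lrb P)).obj
          (fun i => (M.lrb (σ i)).obj ((M.Fpow m).obj X)) := by
      rw [M.lrb_subst, ← Functor.assoc, e₁, Functor.assoc, curry_prod_comp]
      rfl
    have h₂ : (Functor.curry.obj (extend M.Cpe m ⋙ Functor.pi' (fun i => M.flrb (Ty.liftSub σ i)
        (Ty.NonLinear.liftSub hσ i)) ⋙ M.flrb P h)).obj X =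
          (Functor.curry.obj (extend M.Cpe n ⋙ M.flrb P h)).obj
            (fun i => (M.flrb (σ i) (hσ i)).obj X) := by
      rw [← Functor.assoc, e₂, Functor.assoc, curry_prod_comp]
      rfl
    -- Besides a transport, `τ` changes the parameter along the comparisons at the `σ i`, and `η` is
    -- `γ` at the body. The functor `initAlg` sends them to the `⟦μX.P⟧`-action on the comparisons
    -- and to `γ` at `μX.P`, each up to a transport.
    have key := M.alpha_mu_app_comp
      (τ := eqToHom h₁ ≫ (Functor.curry.obj (extend (Emb L) n ⋙ M.lrb P)).map
        (fun i => (M.alpha (σ i) (hσ i)).hom.app X))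
      (η := (Functor.curry.map (Functor.whiskerLeft (extend M.Cpe m) (M.gamma P h (Ty.liftSub σ)
        (Ty.NonLinear.liftSub hσ)).hom)).app X ≫ eqToHom h₂) (fun Y => ?_)
    · rw [Functor.map_comp, Functor.map_comp, eqToHom_map, eqToHom_map] at key
      refine Eq.trans (congrArg (_ ≫ M.Fpe.map ·) ?_) (key.trans (Category.assoc _ _ _))
      exact congrArg (_ ≫ ·) (eqToHom_app (M.flrb_liftSub P h hσ) X)
    -- The inductive hypothesis at the lifted substitution absorbs `γ`, and naturality of `α` at `P`
    -- absorbs the transport along `e₂`. The last goal then compares, under `⟦P⟧`, the tuple of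
    -- comparisons at the lifted substitution with the tuple at `σ` extended by an identity.
    · refine comp_comp_eq_of_squares
        (x₀ := eqToHom (Functor.congr_obj (M.lrb_subst P (Ty.liftSub σ)) _))
        (x := eqToHom (Functor.congr_obj (M.lrb_subst P (Ty.liftSub σ)) _) ≫ (M.lrb P).map
          (fun i => (M.alpha (Ty.liftSub σ i) (Ty.NonLinear.liftSub hσ i)).hom.app
            ((extend M.Cpe m).obj (X, Y))))
        (r₂ := M.Fpe.map ((M.flrb P h).map (eqToHom (Functor.congr_obj e₂ (X, Y)))))
        (w := (M.lrb P).map (eqToHom (Functor.congr_obj e₁ ((M.Fpow m).obj X, M.Fpe.obj Y))) ≫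
          (M.lrb P).map ((extend (Emb L) n).map
            (Prod.mkHom (fun i => (M.alpha (σ i) (hσ i)).hom.app X) (𝟙 (M.Fpe.obj Y)))))
        (z := (M.lrb P).map ((Functor.pi' fun i => M.lrb (Ty.liftSub σ i)).map
            ((extendIso m M.Fpe).hom.app (X, Y))) ≫ (M.lrb P).map
          (fun i => (M.alpha (Ty.liftSub σ i) (Ty.NonLinear.liftSub hσ i)).hom.app
            ((extend M.Cpe m).obj (X, Y))))
        ?_ ((ih h (Ty.liftSub σ) (Ty.NonLinear.liftSub hσ) ((extend M.Cpe m).obj (X, Y))).trans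
          (Category.assoc _ _ _).symm)
        ((M.alpha P h).hom.naturality _).symm ?_ ?_ ?_
      · refine Eq.trans (congrArg M.Fpe.map ?_) (M.Fpe.map_comp _ _)
        refine congrArg (_ ≫ ·) ((eqToHom_app h₂ Y).trans ?_)
        exact (eqToHom_map (M.flrb P h) _).symm
      · exact (Category.assoc _ _ _).symm.trans ((congrArg (· ≫ _) (map_comp_eqToHom
          (M.lrb_subst P _) _)).trans (Category.assoc _ _ _))
      · exact (congrArg (· ≫ _) ((eqToHom_app h₁ _).trans
          (eqToHom_eq_comp_map (M.lrb P) _ _ _))).trans (Category.assoc _ _ _)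
      · refine ((congrArg (· ≫ _) ((M.lrb P).map_comp _ _).symm).trans
          ((M.lrb P).map_comp _ _).symm).trans (Eq.trans (congrArg (M.lrb P).map ?_)
          (((M.lrb P).map_comp _ _).trans (congrArg (· ≫ _) ((M.lrb P).map_comp _ _))))
        have f₁ (i : Fin (n + 1)) : M.Fpe.map ((eqToHom (Functor.congr_obj e₂ (X, Y)) :
            (extend M.Cpe m ⋙ Functor.pi' (fun i => M.flrb (Ty.liftSub σ i)
              (Ty.NonLinear.liftSub hσ i))).obj (X, Y) ⟶ _) i) = eqToHom _ :=
          map_eqToHom_apply M.Fpe _ i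
        have f₂ (i : Fin (n + 1)) :
            (eqToHom (Functor.congr_obj e₁ ((M.Fpow m).obj X, M.Fpe.obj Y)) :
              (extend (Emb L) m ⋙ Functor.pi' (fun i => M.lrb (Ty.liftSub σ i))).obj _ ⟶ _) i =
              eqToHom _ :=
          Functor.eqToHom_proj _ i
        refine funext (Fin.cases ?_ fun i => ?_)
        · refine (congrArg (_ ≫ ·) (f₁ 0)).trans
            (Eq.trans ?_ (congrArg (fun k => (k ≫ _) ≫ _) (f₂ 0)).symm)
          -- The lifted substitution sends the bound variable to itself, where `α` is the identity,
          -- and the transports have definitionally equal endpoints; every factor reduces to an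
          -- identity.
          rfl
        · refine (congrArg (_ ≫ ·) (f₁ i.succ)).trans
            (Eq.trans ?_ (congrArg (fun k => (k ≫ _) ≫ _) (f₂ i.succ)).symm)
          -- On an old variable the lifted substitution is `σ i` weakened by `Fin.succ`, so
          -- stability under renaming replaces its comparison by the one at `σ i`. The factor
          -- `extendIso` is then moved past the transport, where it becomes an identity because only
          -- old variables remain.
          have g₁ := M.alpha_rename (σ i) (hσ i) Fin.succ ((extend M.Cpe m).obj (X, Y))
          rw [eqToHom_map] at g₁
          have g₂ := map_comp_eqToHom (M.lrb_rename (σ i) Fin.succ)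
            ((extendIso m M.Fpe).hom.app (X, Y))
          refine (Category.assoc _ _ _).trans ((congrArg (_ ≫ ·) g₁).trans ?_)
          refine (Category.assoc _ _ _).symm.trans ((congrArg (· ≫ _) g₂).trans ?_)
          refine Eq.trans ?_ (Category.comp_id _).symm
          have g₃ : (reindex (Emb L) Fin.succ ⋙ M.lrb (σ i)).map
              ((extendIso m M.Fpe).hom.app (X, Y)) = 𝟙 _ := (M.lrb (σ i)).map_id _
          exact congrArg (· ≫ _) ((congrArg (eqToHom _ ≫ ·) g₃).trans (Category.comp_id _))

/-! ### Folding -/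

/-- The comparison isomorphisms are compatible with folding. -/
theorem alpha_inst_nlFold {n : ℕ} (P : Ty (n + 1)) (h : P.mu.NonLinear) :
    M.alpha (P.inst P.mu) (h.body.inst h) ≪≫ Functor.isoWhiskerRight (M.nlFold P h) M.Fpe =
      Functor.isoWhiskerLeft (M.Fpow n) (M.fold P) ≪≫ M.alpha P.mu h := by
  ext X : 3
  -- The substitution half of the theorem, for `[μX.P / X]`. Its right side ends in the body square
  -- at the carrier `(|μX.P|) X`, where the square for `φ` can be attached. The identity on the left
  -- only fills the first slot of the pasting lemma.
  have core : (𝟙 _ ≫ (M.alpha (P.inst P.mu) (h.body.inst h)).hom.app X) ≫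
      M.Fpe.map ((M.gammaInst P h.body P.mu h).hom.app X) =
      (eqToHom (Functor.congr_obj (M.lrb_inst P P.mu) ((M.Fpow n).obj X)) ≫
        (M.lrb P).map ((extend (Emb L) n).map
          (Prod.mkHom (𝟙 ((M.Fpow n).obj X)) ((M.alpha P.mu h).hom.app X)))) ≫
      (M.lrb P).map ((extendIso n M.Fpe).hom.app (X, (M.flrb P.mu h).obj X)) ≫
        (M.alpha P h.body).hom.app ((extend M.Cpe n).obj (X, (M.flrb P.mu h).obj X)) := by
    refine comp_comp_eq_of_squares
      (x := eqToHom (Functor.congr_obj (M.lrb_subst P (Ty.single P.mu)) _) ≫ (M.lrb P).map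
        (fun i => (M.alpha (Ty.single P.mu i) (Ty.NonLinear.single h i)).hom.app X))
      (r₂ := M.Fpe.map ((M.flrb P h.body).map (eqToHom (Functor.congr_obj (M.flrb_single P.mu h) X))))
      (w := (M.lrb P).map (eqToHom (Functor.congr_obj (M.lrb_single P.mu) ((M.Fpow n).obj X))) ≫
        (M.lrb P).map ((extend (Emb L) n).map
          (Prod.mkHom (𝟙 ((M.Fpow n).obj X)) ((M.alpha P.mu h).hom.app X))))
      ?_ ((M.alpha_subst P h.body (Ty.single P.mu) (Ty.NonLinear.single h) X).trans
        (Category.assoc _ _ _).symm)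
      ((M.alpha P h.body).hom.naturality _).symm (Category.id_comp _) ?_ ?_
    · refine Eq.trans (congrArg M.Fpe.map ?_) (M.Fpe.map_comp _ _)
      exact congrArg (fun k => _ ≫ (M.flrb P h.body).map k) (eqToHom_app (M.flrb_single P.mu h) X)
    · exact (congrArg (· ≫ _) (eqToHom_eq_comp_map (M.lrb P) _ _ _)).trans (Category.assoc _ _ _)
    · refine ((M.lrb P).map_comp _ _).symm.trans (Eq.trans (congrArg (M.lrb P).map ?_)
        (((M.lrb P).map_comp _ _).trans (congrArg (· ≫ _) ((M.lrb P).map_comp _ _))))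
      have f₁ (i : Fin (n + 1)) : M.Fpe.map ((eqToHom (Functor.congr_obj (M.flrb_single P.mu h) X) :
          (Functor.pi' (fun i => M.flrb (Ty.single P.mu i)
            (Ty.NonLinear.single h i))).obj X ⟶ _) i) = eqToHom _ :=
        map_eqToHom_apply M.Fpe _ i
      have f₂ (i : Fin (n + 1)) :
          (eqToHom (Functor.congr_obj (M.lrb_single P.mu) ((M.Fpow n).obj X)) :
            (Functor.pi' (fun i => M.lrb (Ty.single P.mu i))).obj _ ⟶ _) i = eqToHom _ :=
        Functor.eqToHom_proj _ i
      -- Component `0` is the substituted variable and carries `α` at `μX.P`; the other components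
      -- are variables, where `α` is the identity. All transports have definitionally equal
      -- endpoints and reduce to identities.
      refine funext (Fin.cases ?_ fun i => ?_)
      · refine (congrArg (_ ≫ ·) (f₁ 0)).trans
          (Eq.trans ?_ (congrArg (fun k => (k ≫ _) ≫ _) (f₂ 0)).symm)
        exact (Category.comp_id _).trans
          ((Category.id_comp _).symm.trans (Category.comp_id _).symm)
      · refine (congrArg (_ ≫ ·) (f₁ i.succ)).trans
          (Eq.trans ?_ (congrArg (fun k => (k ≫ _) ≫ _) (f₂ i.succ)).symm)
        exact (Category.comp_id _).trans
          ((Category.id_comp _).symm.trans (Category.comp_id _).symm)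
  refine (congrArg (_ ≫ ·) (M.Fpe.map_comp _ _)).trans ((Category.assoc _ _ _).symm.trans ?_)
  refine (congrArg (· ≫ _) ((congrArg (· ≫ _) (Category.id_comp _).symm).trans core)).trans ?_
  refine Eq.trans ?_ (congrArg (· ≫ _) (congrArg (· ≫ _)
    (eqToHom_app (M.lrb_inst P P.mu) ((M.Fpow n).obj X)).symm))
  refine Eq.trans ?_ (Category.assoc _ _ _).symm
  -- With the substitution square in place, the remaining factors are exactly the two sides of the
  -- square for the initial algebra structure maps.
  refine Eq.trans ?_ (congrArg (_ ≫ ·) (M.daggerIso_comp_alpha_mu P h X).symm)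
  exact (Category.assoc _ _ _).trans ((Category.assoc _ _ _).trans rfl)

end LNLModel

end LNLFPC

theorem mainTheorem4
    {C : Type u₁} [Category.{v₁} C] [LNLFPC.CPOCategory C]
    [CartesianMonoidalCategory C] [BraidedCategory C] [HasFiniteCoproducts C]
    [LNLFPC.CPOCartesian C] [LNLFPC.CPOCoproducts C]
    {L : Type u₂} [Category.{v₂} L] [LNLFPC.CPOCategory L]
    [MonoidalCategory L] [SymmetricCategory L] [MonoidalClosed L] [HasFiniteCoproducts L]
    [LNLFPC.CPOMonoidalClosed L] [LNLFPC.CPOCoproducts L]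
    [LNLFPC.HasEInitial L] [LNLFPC.HasOmegaColimitsOfEmbeddings L]
    (M : LNLFPC.LNLModel C L) {n : ℕ} (P : LNLFPC.Ty (n + 1)) (h : P.mu.NonLinear) :
    M.alpha (P.inst P.mu) (h.body.inst h) ≪≫ Functor.isoWhiskerRight (M.nlFold P h) M.Fpe =
      Functor.isoWhiskerLeft (M.Fpow n) (M.fold P) ≪≫ M.alpha P.mu h :=
  M.alpha_inst_nlFold P h
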